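/- **Setting (Model 1).** Let $\lambda,c,\alpha,\xi,V>0$, let $R\ge 1$, let $\boldsymbol p=(p_1,\dots,p_R)$ be a probability vector, and let $0\le M_1<M$ be integers. On a probability space let $\{t_k\}_{k\ge1}$ be a Poisson point process of rate $\lambda$ on $\mathbb R_+$ (strike times); let $n_k$ be i.i.d. with $P\{n_k=j\}=p_j$, $j=1,\dots,R$ (nodes lost at the $k$-th strike); let $w_{jk}$ be i.i.d. $\mathrm{Gamma}(\alpha,\xi)$ with shape $\alpha$ and rate $\xi$ (node weights); the families $\{t_k\},\{n_k\},\{w_{jk}\}$ are independent. Observations are made at $\tau_0=0$ and $\tau_n$ with $\tau_n-\tau_{n-1}=c$ a.s. for $n\ge1$. For Borel $T\subseteq\mathbb R_+$ put $\mathcal N(T)=\sum_{k:\,t_k\in T}n_k$ and $\mathcal W(T)=\sum_{k:\,t_k\in T}\sum_{j=1}^{n_k}w_{jk}$. Let $X_0=\mathcal N([0,\tau_0])$, $Y_0=\mathcal W([0,\tau_0])$, $X_n=\mathcal N((\tau_{n-1},\tau_n])$, $Y_n=\mathcal W((\tau_{n-1},\tau_n])$ for $n\ge1$, and $N_n=\sum_{i=0}^nX_i$,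 $W_n=\sum_{i=0}^nY_i$. The exit indices are $$\mu_1=\inf\{n\ge0:N_n>M_1\},\qquad \mu=\inf\{n\ge0:N_n>M\},\qquad \nu=\inf\{n\ge0:W_n>V\}\qquad(\inf\emptyset=\infty).$$ **Theorem 4.1.** For all $u,v,\theta\in\mathbb C$ with $|u|\le1$, $\mathrm{Re}\,v\ge0$, $\mathrm{Re}\,\theta\ge0$, the random variable $u^{N_{\mu_1}}e^{-vW_{\mu_1}}e^{-\theta\tau_{\mu_1}}\mathbf 1_{\{\mu_1<\min(\mu,\nu)\}}$ is integrable and $$\begin{aligned} E\Big[u^{N_{\mu_1}}&e^{-vW_{\mu_1}}e^{-\theta\tau_{\mu_1}}\mathbf 1_{\{\mu_1<\min(\mu,\nu)\}}\Big]\\ =e^{-c(\theta+\lambda)}\Bigg\{&\sum_{k=0}^{M_1}u^kF_k(\theta,\boldsymbol p)\sum_{m=0}^{M-k}u^mE_m(\boldsymbol p)\Big(\frac{\xi}{v+\xi}\Big)^{\alpha(k+m)}P\big(\alpha(k+m),(v+\xi)V\big)\\ &-\sum_{k=0}^{M_1}u^k\Big(\frac{\xi}{\xi+v}\Big)^{\alpha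 k}P\big(\alpha k,(v+\xi)V\big)\sum_{n=0}^kE_n(\boldsymbol p)F_{k-n}(\theta,\boldsymbol p)\Bigg\}, \end{aligned}$$ where, with sums over $\boldsymbol\beta=(\beta_1,\dots,\beta_R)\in\mathbb N_0^R$, $$E_j(\boldsymbol p)=\sum_{r=0}^{\lfloor\frac{R-1}{R}j\rfloor}(c\lambda)^{j-r}\sum_{\substack{\beta_1+\cdots+\beta_R=j-r\\ 1\beta_1+2\beta_2+\cdots+R\beta_R=j}}\frac{p_1^{\beta_1}\cdots p_R^{\beta_R}}{\beta_1!\cdots\beta_R!},$$ $$F_j(\theta,\boldsymbol p)=\mathbf 1_{\{j=0\}}+\sum_{r=0}^{\lfloor\frac{R-1}{R}j\rfloor}(c\lambda)^{j-r}\,\mathrm{Li}_{-(j-r)}\big(e^{-c(\theta+\lambda)}\big)\sum_{\substack{\beta_1+\cdots+\beta_R=j-r\\ 1\beta_1+2\beta_2+\cdots+R\beta_R=j}}\frac{p_1^{\beta_1}\cdots p_R^{\beta_R}}{\beta_1!\cdots\beta_R!},$$ $\mathrm{Li}_s(z)=\sum_{k\ge1}z^kk^{-s}$ is the polylogarithm,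 and $P(a,z)=1-\Gamma(a,z)/\Gamma(a)$ is the regularized gamma function, with $\Gamma(a,z)=\int_z^\infty x^{a-1}e^{-x}\,dx$ and $P(0,z)=1$. Complex powers are principal. -/

import Mathlib

open MeasureTheory ProbabilityTheory
open scoped ENNReal NNReal

noncomputable section

namespace StrikeNetwork

/-! ### Special functions -/

/-- The polylogarithm `Li_s(z) = ∑_{k ≥ 1} z^k k^{-s}` of integer order, for `‖z‖ < 1`. -/
def polylog (s : ℤ) (z : ℂ) : ℂ :=
  ∑' k : ℕ, z ^ (k + 1) * ((k : ℂ) + 1) ^ (-s)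

/-- The (upper) incomplete gamma function `Γ(a, z) = ∫_z^∞ x^{a-1} e^{-x} dx` for `Re z > 0`; the
path of integration is the ray `x = z s`, `s` from `1` to `∞`, and powers are principal. -/
def incompleteGamma (a : ℝ) (z : ℂ) : ℂ :=
  ∫ s in Set.Ioi (1 : ℝ), (z * (s : ℂ)) ^ ((a : ℂ) - 1) * Complex.exp (-(z * (s : ℂ))) * z

/-- The regularized gamma function `P(a, z) = 1 - Γ(a, z) / Γ(a)`, with `P(0, z) = 1`
(its limit as `a → 0+`, since `1 / Γ(0) = 0`). -/
def regularizedGamma (a : ℝ) (z : ℂ) : ℂ :=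
  if a = 0 then 1 else 1 - incompleteGamma a z / Complex.Gamma (a : ℂ)

/-! ### Coefficients -/

/-- The sum of `p_1^{β_1} ⋯ p_R^{β_R} / (β_1! ⋯ β_R!)` over all `β ∈ ℕ₀^R` with
`β_1 + ⋯ + β_R = j - r` and `1 β_1 + 2 β_2 + ⋯ + R β_R = j`. The entry `p i` stands for
`p_{i+1}`, because `Fin R = {0, …, R-1}`. -/
def multiSum {R : ℕ} (p : Fin R → ℝ) (j r : ℕ) : ℝ :=
  ∑ β ∈ (Finset.piAntidiag (Finset.univ : Finset (Fin R)) (j - r)).filter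
      (fun β : Fin R → ℕ => ∑ i : Fin R, ((i : ℕ) + 1) * β i = j),
    ∏ i, p i ^ β i / ((β i).factorial : ℝ)

/-- `E_j(p)`; the natural number division is `⌊(R-1) j / R⌋`. -/
def coeffE {R : ℕ} (c lam : ℝ) (p : Fin R → ℝ) (j : ℕ) : ℝ :=
  ∑ r ∈ Finset.range ((R - 1) * j / R + 1), (c * lam) ^ (j - r) * multiSum p j r

/-- `F_j(θ, p)`, with the extra summand `1` for `j = 0`. -/
def coeffF {R : ℕ} (c lam : ℝ) (p : Fin R → ℝ) (θ : ℂ) (j : ℕ) : ℂ :=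
  (if j = 0 then 1 else 0) +
  ∑ r ∈ Finset.range ((R - 1) * j / R + 1),
    ((c * lam : ℝ) : ℂ) ^ (j - r) *
      polylog (-((j - r : ℕ) : ℤ)) (Complex.exp (-(c * (θ + lam)))) * (multiSum p j r : ℂ)

/-! ### The stochastic model -/

/-- The number of points `t_k(ω)` in `T`, i.e. `(∑_k ε_{t_k})(T)`, with values in `{0, 1, …, ∞}`. -/
def pointCount {Ω : Type*} (t : ℕ → Ω → ℝ) (T : Set ℝ) (ω : Ω) : ℕ∞ :=
  Set.encard {k : ℕ | t k ω ∈ T}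

/-- The points `t_k` form a homogeneous Poisson point process of rate `lam` on `[0, ∞)`: the number
of points in a Borel set of finite Lebesgue measure `|T|` is Poisson with parameter `lam |T|`,
and the numbers of points in pairwise disjoint sets are independent. -/
structure IsPoissonProcess {Ω : Type*} [MeasurableSpace Ω] (P : Measure Ω)
    (t : ℕ → Ω → ℝ) (lam : ℝ) : Prop where
  measurable : ∀ k, Measurable (t k)
  nonneg : ∀ k ω, 0 ≤ t k ω
  law : ∀ T : Set ℝ, MeasurableSet T → T ⊆ Set.Ici 0 → volume T ≠ ∞ → ∀ m : ℕ,
    P {ω | pointCount t T ω = m} =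
      ENNReal.ofReal (Real.exp (-(lam * volume.real T)) * (lam * volume.real T) ^ m / m.factorial)
  indep : ∀ (d : ℕ) (T : Fin d → Set ℝ), (∀ i, MeasurableSet (T i)) → (∀ i, T i ⊆ Set.Ici 0) →
    (∀ i, volume (T i) ≠ ∞) → Pairwise (fun i j => Disjoint (T i) (T j)) →
    iIndepFun (fun i => pointCount t (T i)) P

/-- The standing assumptions: strikes at the points `t_k` of a Poisson process of rate `lam`, the
`k`-th strike destroying `n_k` nodes with weights `w_{1k}, w_{2k}, …`; `n_k` are i.i.d. with
`P{n_k = i + 1} = p i`, `i = 0, …, R-1`; `w_{jk}` are i.i.d. Gamma with shape `α` and rate `ξ`;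
the three families are independent; observations are made at `τ_0 = 0` and then with constant
inter-observation time `c`. All sequences are indexed from `0`. -/
structure IsConstantObservationModel {Ω : Type*} [MeasurableSpace Ω] (P : Measure Ω)
    (t : ℕ → Ω → ℝ) (n : ℕ → Ω → ℕ) (w : ℕ → ℕ → Ω → ℝ) (τ : ℕ → Ω → ℝ)
    (lam c α ξ : ℝ) {R : ℕ} (p : Fin R → ℝ) : Prop where
  poisson : IsPoissonProcess P t lam
  measurable_nodes : ∀ k, Measurable (n k)
  law_nodes : ∀ k (i : Fin R), P {ω | n k ω = (i : ℕ) + 1} = ENNReal.ofReal (p i)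
  indep_nodes : iIndepFun n P
  measurable_weight : ∀ j k, Measurable (w j k)
  law_weight : ∀ j k, P.map (w j k) = gammaMeasure α ξ
  indep_weight : iIndepFun (fun jk : ℕ × ℕ => w jk.1 jk.2) P
  indep_nodes_weight :
    IndepFun (fun ω k => n k ω) (fun ω (jk : ℕ × ℕ) => w jk.1 jk.2 ω) P
  indep_times_marks :
    IndepFun (fun ω k => t k ω)
      (fun ω => ((fun k => n k ω), (fun jk : ℕ × ℕ => w jk.1 jk.2 ω))) P
  obs_zero : ∀ᵐ ω ∂P, τ 0 ω = 0
  obs_step : ∀ i, ∀ᵐ ω ∂P, τ (i + 1) ω - τ i ω = c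

/-- `𝒩(T)`: the number of nodes lost at the strikes in `T`. -/
def nodesIn {Ω : Type*} (t : ℕ → Ω → ℝ) (n : ℕ → Ω → ℕ) (T : Set ℝ) (ω : Ω) : ℕ :=
  ∑' k, T.indicator (fun _ => n k ω) (t k ω)

/-- `𝒲(T)`: the total weight `∑_{t_k ∈ T} (w_{1k} + ⋯ + w_{n_k k})` lost at the strikes in `T`. -/
def weightIn {Ω : Type*} (t : ℕ → Ω → ℝ) (n : ℕ → Ω → ℕ) (w : ℕ → ℕ → Ω → ℝ) (T : Set ℝ)
    (ω : Ω) : ℝ :=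
  ∑' k, T.indicator (fun _ => ∑ j ∈ Finset.range (n k ω), w j k ω) (t k ω)

/-- The `i`-th observation window: `[0, τ_0]` for `i = 0` and `(τ_{i-1}, τ_i]` for `i ≥ 1`. -/
def window {Ω : Type*} (τ : ℕ → Ω → ℝ) (ω : Ω) : ℕ → Set ℝ
  | 0 => Set.Icc 0 (τ 0 ω)
  | i + 1 => Set.Ioc (τ i ω) (τ (i + 1) ω)

/-- `N_m = X_0 + ⋯ + X_m`, `X_i` the number of nodes lost in the `i`-th observation window. -/
def observedNodes {Ω : Type*} (t : ℕ → Ω → ℝ) (n : ℕ → Ω → ℕ) (τ : ℕ → Ω → ℝ)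
    (m : ℕ) (ω : Ω) : ℕ :=
  ∑ i ∈ Finset.range (m + 1), nodesIn t n (window τ ω i) ω

/-- `W_m = Y_0 + ⋯ + Y_m`, `Y_i` the weight lost in the `i`-th observation window. -/
def observedWeight {Ω : Type*} (t : ℕ → Ω → ℝ) (n : ℕ → Ω → ℕ) (w : ℕ → ℕ → Ω → ℝ)
    (τ : ℕ → Ω → ℝ) (m : ℕ) (ω : Ω) : ℝ :=
  ∑ i ∈ Finset.range (m + 1), weightIn t n w (window τ ω i) ω

/-- The exit index `inf {m ≥ 0 : S_m > b}`, equal to `∞` if there is no such `m`. -/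
def exitIndex {β : Type*} [LT β] (S : ℕ → β) (b : β) : ℕ∞ :=
  ⨅ (m : ℕ) (_ : b < S m), (m : ℕ∞)

end StrikeNetwork

end

/-! Almost surely the observed node counts increase from `N 0 = 0`, so a finite exit index is `m +
1` for the unique `m` with `N m ≤ M₁ < N (m + 1)`, and the event that this exit precedes the other
two becomes `N (m + 1) ≤ M` and `W (m + 1) ≤ V`. Hence `Z` is a series over `m` with at most one
nonzero term on each path (`exists_exitTerm`). Its partial sums are bounded by 1, so dominated
convergence permits integration term by term.

Each term is split by `k = N m` and `j = N (m + 1) - N m` (`exitTerm_eq_sum_markKernel`). Freeze the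
strike times, then the node counts: whichever nodes are lost, the total weight is a sum of `k + j`
i.i.d. gamma variables, so it contributes only its truncated Laplace transform `gammaTrunc`. Strike
counts in the disjoint windows `(0, cm]` and `(cm, c(m+1)]` are independent, so the rest is a
product of compound Poisson masses (`integral_markKernel_strikes`). The second is `e^{-λc} E_j`,
independent of `m`. The first is `e^{-λcm}` times a polynomial in `m`; weighted by `e^{-θc(m+1)}`
and summed over `m` it gives polylogarithms, that is `F_k` (`hasSum_compoundPoissonMass`).

What remains is a sum over `k ≤ M₁ < k + j ≤ M`. It is the sum over all `k + j ≤ M` less the part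
with `k + j ≤ M₁`, and regrouping the latter by `k + j` yields the convolution of `E` and `F`
(`sum_filter_lt_add`). -/

noncomputable section

/-! ### Laplace transforms of gamma distributions -/

section GammaLaplace

lemma integral_gammaMeasure {E : Type*} [NormedAddCommGroup E] [NormedSpace ℝ E] {a r : ℝ}
    (ha : 0 < a) (hr : 0 < r) (f : ℝ → E) :
    ∫ x, f x ∂(gammaMeasure a r) =
      ∫ x in Set.Ioi 0, (r ^ a / Real.Gamma a * x ^ (a - 1) * Real.exp (-(r * x))) • f x := by
  rw [gammaMeasure, integral_withDensity_eq_integral_toReal_smul]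
  · rw [← integral_indicator measurableSet_Ioi]
    refine integral_congr_ae ?_
    filter_upwards [Measure.ae_ne volume (0 : ℝ)] with x hx
    rw [gammaPDF, ENNReal.toReal_ofReal (gammaPDFReal_nonneg ha hr x), gammaPDFReal]
    rcases lt_or_gt_of_ne hx with h | h
    · simp [h.le, not_le.2 h]
    · simp [h, h.le]
  · exact (measurable_gammaPDFReal a r).ennreal_ofReal
  · simp [gammaPDF]

lemma mgf_gammaMeasure {a r t : ℝ} (ha : 0 < a) (hr : 0 < r) (ht : t < r) :
    mgf id (gammaMeasure a r) t = (r / (r - t)) ^ a := by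
  have hrt : 0 < r - t := sub_pos.2 ht
  rw [mgf, integral_gammaMeasure ha hr]
  have : ∀ x : ℝ, (r ^ a / Real.Gamma a * x ^ (a - 1) * Real.exp (-(r * x))) •
      Real.exp (t * id x) =
        r ^ a / Real.Gamma a * (x ^ (a - 1) * Real.exp (-((r - t) * x))) := by
    intro x
    rw [smul_eq_mul, id, mul_assoc (_ * _), ← Real.exp_add, mul_assoc]
    ring_nf
  simp_rw [this]
  rw [integral_const_mul, Real.integral_rpow_mul_exp_neg_mul_Ioi ha hrt,
    Real.div_rpow hr.le hrt.le, Real.div_rpow zero_le_one hrt.le, Real.one_rpow]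
  field_simp [(Real.Gamma_pos_of_pos ha).ne']

/-- Were the exponential not integrable, `mgf` would take its default value 0, whereas the closed
form is positive. -/
lemma Iio_subset_integrableExpSet_gammaMeasure {a r : ℝ} (ha : 0 < a) (hr : 0 < r) :
    Set.Iio r ⊆ integrableExpSet id (gammaMeasure a r) := by
  intro t ht
  by_contra h
  have h0 := mgf_undef h
  rw [mgf_gammaMeasure ha hr ht] at h0
  exact (Real.rpow_pos_of_pos (div_pos hr (sub_pos.2 ht)) a).ne' h0

/-- Identity theorem on the half-plane `re < r`: both sides are analytic there and agree at real
points accumulating at 0. -/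
lemma complexMGF_gammaMeasure {a r : ℝ} (ha : 0 < a) (hr : 0 < r) {z : ℂ} (hz : z.re < r) :
    complexMGF id (gammaMeasure a r) z = ((r : ℂ) / (r - z)) ^ (a : ℂ) := by
  have hopen : IsOpen {w : ℂ | w.re < r} := isOpen_lt Complex.continuous_re continuous_const
  have hsub : Set.Iio r ⊆ interior (integrableExpSet id (gammaMeasure a r)) :=
    interior_maximal (Iio_subset_integrableExpSet_gammaMeasure ha hr) isOpen_Iio
  -- The quotient has positive real part, so it avoids the branch cut of the principal power.
  have hslit : ∀ w : ℂ, w.re < r → (r : ℂ) / (r - w) ∈ Complex.slitPlane := by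
    intro w hw
    left
    have hre : 0 < ((r : ℂ) - w).re := by simpa using hw
    have hne : (r : ℂ) - w ≠ 0 := fun h => by simp [h] at hre
    rw [Complex.div_re]
    have := Complex.normSq_pos.2 hne
    simp only [Complex.ofReal_re, Complex.ofReal_im, zero_mul, zero_div, add_zero]
    positivity
  refine AnalyticOnNhd.eqOn_of_preconnected_of_frequently_eq (z₀ := (0 : ℂ))
    (U := {w : ℂ | w.re < r}) (f := complexMGF id (gammaMeasure a r))
    (g := fun z => ((r : ℂ) / (r - z)) ^ (a : ℂ)) ?_ ?_ ?_ ?_ ?_ hz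
  · exact fun w hw => analyticAt_complexMGF (hsub hw)
  · refine DifferentiableOn.analyticOnNhd (fun w hw => ?_) hopen
    have hre : 0 < ((r : ℂ) - w).re := by simpa using hw
    have hne : (r : ℂ) - w ≠ 0 := fun h => by simp [h] at hre
    refine DifferentiableAt.differentiableWithinAt ?_
    refine DifferentiableAt.cpow_const ?_ (hslit w hw)
    exact (differentiableAt_const _).div ((differentiableAt_const _).sub differentiableAt_id) hne
  · exact (convex_halfSpace_re_lt r).isPreconnected
  · simpa using hr
  -- The points `-1/(n+1)` are negative, hence lie in the half-plane for every `r > 0`.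
  · have hev : ∀ᶠ n : ℕ in Filter.atTop, complexMGF id (gammaMeasure a r)
        ((-(1 / ((n : ℝ) + 1)) : ℝ) : ℂ)
        = ((r : ℂ) / (r - ((-(1 / ((n : ℝ) + 1)) : ℝ) : ℂ))) ^ (a : ℂ) := by
      refine Filter.Eventually.of_forall fun n => ?_
      have hn : 0 < 1 / ((n : ℝ) + 1) := Nat.one_div_pos_of_nat
      rw [complexMGF_ofReal, mgf_gammaMeasure ha hr (by linarith), Complex.ofReal_cpow]
      · push_cast; rfl
      · exact div_nonneg hr.le (by linarith)
    have ht : Filter.Tendsto (fun n : ℕ => ((-(1 / ((n : ℝ) + 1)) : ℝ) : ℂ)) Filter.atTop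
        (nhdsWithin 0 {0}ᶜ) := by
      refine tendsto_nhdsWithin_iff.2 ⟨?_, Filter.Eventually.of_forall fun n => ?_⟩
      · have := (tendsto_one_div_add_atTop_nhds_zero_nat (𝕜 := ℝ)).neg
        rw [neg_zero] at this
        exact (Complex.continuous_ofReal.tendsto' 0 0 (by simp)).comp this
      · have hn : 0 < 1 / ((n : ℝ) + 1) := Nat.one_div_pos_of_nat
        simp only [Set.mem_compl_iff, Set.mem_singleton_iff, Complex.ofReal_eq_zero]
        linarith
    exact ht.frequently hev.frequently

lemma integrable_cexp_neg_mul_gammaMeasure {a r : ℝ} (ha : 0 < a) (hr : 0 < r) {v : ℂ}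
    (hv : 0 ≤ v.re) : Integrable (fun x : ℝ => Complex.exp (-(v * x))) (gammaMeasure a r) := by
  have := (Iio_subset_integrableExpSet_gammaMeasure ha hr)
    (show -v.re ∈ Set.Iio r by simp only [Set.mem_Iio]; linarith)
  refine Integrable.mono' this (by fun_prop) (Filter.Eventually.of_forall fun x => ?_)
  simp [Complex.norm_exp]

lemma ofReal_mul_cpow {x : ℝ} (hx : 0 < x) {z : ℂ} (hz : z ≠ 0) (s : ℂ) :
    ((x : ℂ) * z) ^ s = (x : ℂ) ^ s * z ^ s := by
  have hx' : (x : ℂ) ≠ 0 := by exact_mod_cast hx.ne'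
  rw [Complex.cpow_def_of_ne_zero (mul_ne_zero hx' hz), Complex.cpow_def_of_ne_zero hx',
    Complex.cpow_def_of_ne_zero hz, Complex.log_ofReal_mul hx hz, ← Complex.ofReal_log hx.le,
    add_mul, Complex.exp_add]

/-- The full Laplace transform minus the tail over `(V, ∞)`. On the tail the substitution `x = V s`
produces the ray integral that defines `incompleteGamma`. -/
lemma integral_indicator_cexp_gammaMeasure {a r V : ℝ} (ha : 0 < a) (hr : 0 < r) (hV : 0 < V)
    {v : ℂ} (hv : 0 ≤ v.re) :
    ∫ x, (Set.Iic V).indicator (fun x : ℝ => Complex.exp (-(v * x))) x ∂(gammaMeasure a r) =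
      ((r : ℂ) / (v + r)) ^ (a : ℂ) * StrikeNetwork.regularizedGamma a ((v + r) * V) := by
  have hint := integrable_cexp_neg_mul_gammaMeasure ha hr hv
  have hre : 0 < (v + r).re := by simp; linarith
  have hne : v + r ≠ 0 := fun h => by simp [h] at hre
  have hΓ : Complex.Gamma a ≠ 0 := by
    rw [Complex.Gamma_ofReal]; exact_mod_cast (Real.Gamma_pos_of_pos ha).ne'
  have hfull : ∫ x : ℝ, Complex.exp (-(v * x)) ∂(gammaMeasure a r) =
      ((r : ℂ) / (v + r)) ^ (a : ℂ) := by
    have := complexMGF_gammaMeasure ha hr (z := -v) (by simp; linarith)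
    simpa [complexMGF, add_comm] using this
  have htail : ∫ x in Set.Ioi V, Complex.exp (-(v * x)) ∂(gammaMeasure a r) =
      ((r : ℂ) / (v + r)) ^ (a : ℂ) *
        (StrikeNetwork.incompleteGamma a ((v + r) * V) / Complex.Gamma a) := by
    rw [← integral_indicator measurableSet_Ioi, integral_gammaMeasure ha hr]
    have h1 : ∫ x in Set.Ioi (0 : ℝ), (r ^ a / Real.Gamma a * x ^ (a - 1) *
          Real.exp (-(r * x))) • (Set.Ioi V).indicator (fun x : ℝ => Complex.exp (-(v * x))) x =
        ∫ x in Set.Ioi V, ((r : ℂ) ^ (a : ℂ) / Complex.Gamma a) * ((x : ℂ) ^ ((a : ℂ) - 1) *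
          Complex.exp (-((v + r) * x))) := by
      rw [← integral_indicator measurableSet_Ioi, ← integral_indicator measurableSet_Ioi]
      congr 1 with x
      by_cases hx : V < x
      · have hx0 : 0 < x := hV.trans hx
        simp only [Set.indicator, Set.mem_Ioi, hx, hx0, if_true, Complex.real_smul]
        push_cast [Complex.ofReal_cpow hr.le, Complex.ofReal_cpow hx0.le, Complex.Gamma_ofReal]
        rw [show -((v + r) * (x : ℂ)) = -(r * x) + -(v * x) by ring, Complex.exp_add]
        ring
      · simp [Set.indicator, hx]
    rw [h1, integral_const_mul, StrikeNetwork.incompleteGamma]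
    have h2 : ∫ s in Set.Ioi (1 : ℝ), ((v + r) * V * (s : ℂ)) ^ ((a : ℂ) - 1) *
          Complex.exp (-((v + r) * V * (s : ℂ))) * ((v + r) * V) =
        (v + r) ^ (a : ℂ) * (V • ∫ s in Set.Ioi (1 : ℝ), ((V * s : ℝ) : ℂ) ^ ((a : ℂ) - 1) *
          Complex.exp (-((v + r) * ((V * s : ℝ) : ℂ)))) := by
      rw [Complex.real_smul, ← integral_const_mul, ← integral_const_mul]
      refine setIntegral_congr_fun measurableSet_Ioi fun s hs => ?_
      have hs0 : 0 < V * s := mul_pos hV (zero_lt_one.trans hs)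
      have e1 : (v + r) * V * (s : ℂ) = ((V * s : ℝ) : ℂ) * (v + r) := by push_cast; ring
      have e2 : (v + r) ^ (a : ℂ) = (v + r) ^ ((a : ℂ) - 1) * (v + r) := by
        rw [Complex.cpow_sub _ _ hne, Complex.cpow_one, div_mul_cancel₀ _ hne]
      rw [e1, ofReal_mul_cpow hs0 hne, e2, mul_comm (v + r) ((V * s : ℝ) : ℂ)]
      ring
    rw [h2, integral_comp_mul_left_Ioi
      (fun y : ℝ => (y : ℂ) ^ ((a : ℂ) - 1) * Complex.exp (-((v + r) * (y : ℂ)))) 1 hV,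
      mul_one, smul_smul, mul_inv_cancel₀ hV.ne', one_smul]
    -- The principal power commutes with inversion off the negative axis, and `v + r` has positive
    -- real part.
    have h3 : ((r : ℂ) / (v + r)) ^ (a : ℂ) * (v + r) ^ (a : ℂ) = (r : ℂ) ^ (a : ℂ) := by
      have harg : Complex.arg (v + r) ≠ Real.pi := by
        intro h
        have := (Complex.arg_eq_pi_iff.1 h).1
        linarith
      rw [div_eq_mul_inv, ofReal_mul_cpow hr (inv_ne_zero hne), Complex.inv_cpow _ _ harg, mul_assoc,
        inv_mul_cancel₀, mul_one]
      rw [Ne, Complex.cpow_eq_zero_iff]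
      simp [hne]
    rw [← h3]
    ring
  rw [integral_indicator measurableSet_Iic]
  have hsplit := integral_add_compl (μ := gammaMeasure a r) (measurableSet_Iic (a := V)) hint
  rw [Set.compl_Iic, htail, hfull] at hsplit
  rw [eq_sub_of_add_eq hsplit, StrikeNetwork.regularizedGamma, if_neg ha.ne']
  ring

/-- Sums of finitely many i.i.d. gamma variables are gamma distributed. -/
lemma map_sum_gammaMeasure {Ω ι : Type*} [MeasurableSpace Ω] {P : Measure Ω}
    [IsProbabilityMeasure P] {a r : ℝ} (ha : 0 < a) (hr : 0 < r) {w : ι → Ω → ℝ}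
    (hw : ∀ i, Measurable (w i)) (hlaw : ∀ i, P.map (w i) = gammaMeasure a r)
    (hind : iIndepFun w P) {J : Finset ι} (hJ : J.Nonempty) :
    P.map (fun ω => ∑ i ∈ J, w i ω) = gammaMeasure (a * J.card) r := by
  have hcard : 0 < a * J.card := mul_pos ha (by exact_mod_cast hJ.card_pos)
  have := isProbabilityMeasure_gammaMeasure hcard hr
  have := Measure.isProbabilityMeasure_map (μ := P)
    (Finset.measurable_sum J fun i _ => hw i).aemeasurable
  refine Measure.ext_of_charFun ?_
  ext s
  rw [iIndepFun.charFun_map_fun_finsetSum_eq_prod (fun i _ => (hw i).aemeasurable)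
    (iIndepFun_iff_finset.1 hind J)]
  have hz : ((s : ℂ) * Complex.I).re < r := by simpa using hr
  simp_rw [hlaw]
  rw [Finset.prod_const, Pi.pow_apply, ← complexMGF_id_mul_I, ← complexMGF_id_mul_I,
    complexMGF_gammaMeasure ha hr hz, complexMGF_gammaMeasure hcard hr hz,
    ← Complex.cpow_mul_nat]
  push_cast
  rfl

/-- For empty `J` the sum is 0 and there is no gamma law; the convention `P(0, z) = 1` makes the
formula hold there too. -/
lemma integral_indicator_cexp_sum {Ω ι : Type*} [MeasurableSpace Ω] {P : Measure Ω}
    [IsProbabilityMeasure P] {a r V : ℝ} (ha : 0 < a) (hr : 0 < r) (hV : 0 < V) {v : ℂ}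
    (hv : 0 ≤ v.re) {w : ι → Ω → ℝ} (hw : ∀ i, Measurable (w i))
    (hlaw : ∀ i, P.map (w i) = gammaMeasure a r) (hind : iIndepFun w P) (J : Finset ι) :
    ∫ ω, (Set.Iic V).indicator (fun x : ℝ => Complex.exp (-(v * x))) (∑ i ∈ J, w i ω) ∂P =
      ((r : ℂ) / (v + r)) ^ ((a * J.card : ℝ) : ℂ) *
        StrikeNetwork.regularizedGamma (a * J.card) ((v + r) * V) := by
  rcases J.eq_empty_or_nonempty with rfl | hJ
  · simp [StrikeNetwork.regularizedGamma, hV.le]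
  · have hcard : 0 < a * J.card := mul_pos ha (by exact_mod_cast hJ.card_pos)
    rw [← integral_indicator_cexp_gammaMeasure hcard hr hV hv,
      ← map_sum_gammaMeasure ha hr hw hlaw hind hJ, integral_map]
    · exact (Finset.measurable_sum J fun i _ => hw i).aemeasurable
    · refine (Measurable.indicator ?_ measurableSet_Iic).aestronglyMeasurable
      fun_prop

end GammaLaplace

/-! ### Compound Poisson coefficients -/

section Coefficients

/-- The probability generating polynomial of the number of nodes lost at a strike. -/
def nodePoly {R : ℕ} (p : Fin R → ℝ) : Polynomial ℝ :=
  ∑ i : Fin R, Polynomial.C (p i) * Polynomial.X ^ ((i : ℕ) + 1)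

/-- The multinomial theorem, with `β i` the number of strikes that destroy `i + 1` nodes. The factor
`a!` later cancels against the Poisson weight. -/
lemma coeff_nodePoly_pow {R : ℕ} (p : Fin R → ℝ) (a k : ℕ) :
    (nodePoly p ^ a).coeff k = a.factorial *
      ∑ β ∈ (Finset.piAntidiag (Finset.univ : Finset (Fin R)) a).filter
        (fun β : Fin R → ℕ => ∑ i : Fin R, ((i : ℕ) + 1) * β i = k),
        ∏ i, p i ^ β i / ((β i).factorial : ℝ) := by
  rw [nodePoly, Finset.sum_pow_eq_sum_piAntidiag, Polynomial.finsetSum_coeff, Finset.mul_sum,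
    Finset.sum_filter]
  refine Finset.sum_congr rfl fun β hβ => ?_
  have hsum : ∑ i, β i = a := (Finset.mem_piAntidiag.1 hβ).1
  have hprod : ∏ i : Fin R, (Polynomial.C (p i) * Polynomial.X ^ ((i : ℕ) + 1)) ^ β i =
      Polynomial.C (∏ i, p i ^ β i) * Polynomial.X ^ (∑ i : Fin R, ((i : ℕ) + 1) * β i) := by
    simp_rw [mul_pow, Finset.prod_mul_distrib, ← pow_mul, Finset.prod_pow_eq_pow_sum,
      ← Polynomial.C_pow, ← map_prod]
  have hspec : (∏ i, ((β i).factorial : ℝ)) * Nat.multinomial Finset.univ β = a.factorial := by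
    have := Nat.multinomial_spec Finset.univ β
    rw [hsum] at this
    exact_mod_cast this
  have hne : (∏ i, ((β i).factorial : ℝ)) ≠ 0 :=
    Finset.prod_ne_zero_iff.2 fun i _ => by positivity
  rw [hprod, ← Polynomial.C_eq_natCast, ← mul_assoc, ← Polynomial.C_mul,
    Polynomial.coeff_C_mul_X_pow]
  simp only [eq_comm (a := k)]
  split_ifs with h
  · rw [Finset.prod_div_distrib, ← hspec]
    field_simp
  · rfl

/-- Each strike destroys between 1 and `R` nodes. -/
lemma coeff_nodePoly_pow_eq_zero {R : ℕ} (p : Fin R → ℝ) {a k : ℕ} (h : k < a ∨ R * a < k) :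
    (nodePoly p ^ a).coeff k = 0 := by
  rw [coeff_nodePoly_pow, Finset.filter_false_of_mem, Finset.sum_empty, mul_zero]
  intro β hβ hk
  have hsum : ∑ i, β i = a := (Finset.mem_piAntidiag.1 hβ).1
  have h1 : a ≤ k := by
    rw [← hsum, ← hk]
    exact Finset.sum_le_sum fun i _ => Nat.le_mul_of_pos_left _ (Nat.succ_pos _)
  have h2 : k ≤ R * a := by
    rw [← hsum, ← hk, Finset.mul_sum]
    exact Finset.sum_le_sum fun i _ => Nat.mul_le_mul_right _ i.2
  omega

/-- Substituting `a = k - r`, the coefficient vanishes unless `a ≤ k ≤ R a`, that is `0 ≤ r ≤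
(R-1)k/R`. This is the origin of the floor in the range of summation, and it makes the series
finite. -/
lemma hasSum_pow_div_factorial_mul_coeff {R : ℕ} (p : Fin R → ℝ) (hR : 0 < R) (x : ℝ) (k : ℕ) :
    HasSum (fun a : ℕ => x ^ a / a.factorial * (nodePoly p ^ a).coeff k)
      (∑ r ∈ Finset.range ((R - 1) * k / R + 1),
        x ^ (k - r) * StrikeNetwork.multiSum p k r) := by
  have hterm : ∀ r, x ^ (k - r) * StrikeNetwork.multiSum p k r =
      x ^ (k - r) / (k - r).factorial * (nodePoly p ^ (k - r)).coeff k := by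
    intro r
    have : ((k - r).factorial : ℝ) ≠ 0 := by positivity
    rw [coeff_nodePoly_pow, StrikeNetwork.multiSum]
    field_simp
  simp_rw [hterm]
  have hle : (R - 1) * k / R ≤ k := by
    rw [Nat.div_le_iff_le_mul_add_pred hR]
    have : (R - 1) * k ≤ R * k := Nat.mul_le_mul_right _ (Nat.sub_le _ _)
    omega
  rw [Finset.sum_subset (s₂ := Finset.range (k + 1))]
  · have := Finset.sum_range_reflect
      (fun a => x ^ a / a.factorial * (nodePoly p ^ a).coeff k) (k + 1)
    simp only [Nat.add_sub_cancel] at this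
    rw [this]
    refine hasSum_sum_of_ne_finset_zero fun a ha => ?_
    rw [coeff_nodePoly_pow_eq_zero p (Or.inl (by simpa [Nat.lt_succ_iff] using ha)), mul_zero]
  · exact Finset.range_mono (by omega)
  · intro r hr hr'
    rw [Finset.mem_range] at hr hr'
    have h1 : (R - 1) * k / R < r := by omega
    rw [Nat.div_lt_iff_lt_mul hR] at h1
    rw [coeff_nodePoly_pow_eq_zero p (Or.inr ?_), mul_zero]
    obtain ⟨d, rfl⟩ := Nat.exists_eq_add_of_le (Nat.lt_succ_iff.1 hr)
    obtain ⟨S, rfl⟩ := Nat.exists_eq_add_of_le' hR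
    simp only [Nat.add_sub_cancel, Nat.add_sub_cancel_left] at *
    nlinarith

lemma coeff_nodePoly_nonneg {R : ℕ} {p : Fin R → ℝ} (hp : ∀ i, 0 ≤ p i) (a k : ℕ) :
    0 ≤ (nodePoly p ^ a).coeff k := by
  rw [coeff_nodePoly_pow]
  exact mul_nonneg (Nat.cast_nonneg _) (Finset.sum_nonneg fun β _ =>
    Finset.prod_nonneg fun i _ => div_nonneg (pow_nonneg (hp i) _) (Nat.cast_nonneg _))

end Coefficients

/-! ### Marks attached to fixed finite sets of strikes -/

section Marks

variable {Ω : Type*} [MeasurableSpace Ω] {P : Measure Ω}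

lemma ae_nonneg_of_map_eq_gammaMeasure {a r : ℝ} {w : Ω → ℝ} (hw : Measurable w)
    (hlaw : P.map w = gammaMeasure a r) : ∀ᵐ ω ∂P, 0 ≤ w ω := by
  have h0 : gammaMeasure a r (Set.Iio 0) = 0 := by
    rw [gammaMeasure, withDensity_apply _ measurableSet_Iio]
    exact lintegral_gammaPDF_of_nonpos le_rfl
  rw [← hlaw, Measure.map_apply hw measurableSet_Iio] at h0
  rw [ae_iff]
  simpa [Set.preimage] using h0

variable [IsProbabilityMeasure P]

/-- Fubini on the product law: `X` may be frozen while `Y` is integrated. It serves to freeze first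
the strike times, then the node counts. -/
lemma integral_comp_of_indepFun {α β : Type*} [MeasurableSpace α] [MeasurableSpace β]
    {X : Ω → α} {Y : Ω → β} (hX : Measurable X) (hY : Measurable Y) (h : IndepFun X Y P)
    {f : α × β → ℂ} (hf : Measurable f) {C : ℝ} (hC : ∀ z, ‖f z‖ ≤ C) :
    ∫ ω, f (X ω, Y ω) ∂P = ∫ ω, ∫ ω', f (X ω, Y ω') ∂P ∂P := by
  have := Measure.isProbabilityMeasure_map (μ := P) hX.aemeasurable
  have := Measure.isProbabilityMeasure_map (μ := P) hY.aemeasurable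
  have hint : Integrable f ((P.map X).prod (P.map Y)) :=
    Integrable.of_bound hf.aestronglyMeasurable C (Filter.Eventually.of_forall hC)
  have h1 : ∫ ω, f (X ω, Y ω) ∂P = ∫ z, f z ∂(P.map (fun ω => (X ω, Y ω))) :=
    (integral_map (hX.prodMk hY).aemeasurable hf.aestronglyMeasurable).symm
  rw [h1, (indepFun_iff_map_prod_eq_prod_map_map hX.aemeasurable hY.aemeasurable).1 h,
    integral_prod _ hint, integral_map hX.aemeasurable]
  · refine integral_congr_ae (Filter.Eventually.of_forall fun ω => ?_)
    exact integral_map hY.aemeasurable (hf.comp measurable_prodMk_left).aestronglyMeasurable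
  · exact (StronglyMeasurable.integral_prod_right (f := fun x y => f (x, y))
      hf.stronglyMeasurable).aestronglyMeasurable

/-- The Laplace kernel `e^{-vx}` truncated to `[0, V]`. -/
def truncExp (v : ℂ) (V : ℝ) : ℝ → ℂ :=
  (Set.Icc 0 V).indicator fun x : ℝ => Complex.exp (-(v * x))

lemma measurable_truncExp (v : ℂ) (V : ℝ) : Measurable (truncExp v V) :=
  Measurable.indicator (by fun_prop) measurableSet_Icc

/-- The cutoff at 0 gives a bound valid for all real `x`, so no almost sure restriction is needed
when Fubini is applied. -/
lemma norm_truncExp_le {v : ℂ} (hv : 0 ≤ v.re) (V x : ℝ) : ‖truncExp v V x‖ ≤ 1 := by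
  rw [truncExp, Set.indicator]
  split_ifs with h
  · rw [Complex.norm_exp, Real.exp_le_one_iff]
    simpa using mul_nonneg hv h.1
  · simp

/-- The Laplace transform of a `Gamma(α l, r)` variable truncated at `V`. -/
def gammaTrunc (a r V : ℝ) (v : ℂ) (l : ℕ) : ℂ :=
  ((r : ℂ) / (v + r)) ^ ((a * l : ℝ) : ℂ) *
    StrikeNetwork.regularizedGamma (a * l) ((v + r) * V)

lemma integral_truncExp_sum {ι : Type*} {a r V : ℝ} (ha : 0 < a) (hr : 0 < r) (hV : 0 < V) {v : ℂ}
    (hv : 0 ≤ v.re) {w : ι → Ω → ℝ} (hw : ∀ i, Measurable (w i))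
    (hlaw : ∀ i, P.map (w i) = gammaMeasure a r) (hind : iIndepFun w P) (J : Finset ι) :
    ∫ ω, truncExp v V (∑ i ∈ J, w i ω) ∂P = gammaTrunc a r V v J.card := by
  rw [gammaTrunc, ← integral_indicator_cexp_sum ha hr hV hv hw hlaw hind]
  refine integral_congr_ae ?_
  have : ∀ᵐ ω ∂P, ∀ i ∈ J, 0 ≤ w i ω :=
    (ae_ball_iff (Finset.countable_toSet J)).2 fun i _ =>
      ae_nonneg_of_map_eq_gammaMeasure (hw i) (hlaw i)
  filter_upwards [this] with ω hω
  simp [truncExp, Set.indicator, Finset.sum_nonneg hω]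

/-- The prescribed probabilities of `1, …, R` already sum to 1, so every other value has probability
0. -/
lemma measureReal_node_eq {R : ℕ} {p : Fin R → ℝ} (hp : ∀ i, 0 ≤ p i) (hp1 : ∑ i, p i = 1)
    {n : Ω → ℕ} (hn : Measurable n)
    (hlaw : ∀ i : Fin R, P {ω | n ω = (i : ℕ) + 1} = ENNReal.ofReal (p i)) (a : ℕ) :
    P.real {ω | n ω = a} = (nodePoly p).coeff a := by
  have hlaw' : ∀ i : Fin R, P.real {ω | n ω = (i : ℕ) + 1} = p i := fun i => by
    rw [measureReal_def, hlaw, ENNReal.toReal_ofReal (hp i)]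
  have hms : ∀ b, MeasurableSet {ω | n ω = b} := fun b => hn (measurableSet_singleton b)
  have hcoeff : (nodePoly p).coeff a = ∑ i : Fin R, if a = (i : ℕ) + 1 then p i else 0 := by
    simp only [nodePoly, Polynomial.finsetSum_coeff, Polynomial.coeff_C_mul_X_pow]
  rw [hcoeff]
  by_cases h : ∃ i : Fin R, a = (i : ℕ) + 1
  · obtain ⟨i, rfl⟩ := h
    rw [hlaw', Finset.sum_eq_single i]
    · simp
    · intro j _ hj
      rw [if_neg]
      intro h
      exact hj (Fin.ext (by omega))
    · simp
  · push Not at h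
    rw [Finset.sum_eq_zero fun i _ => if_neg (h i)]
    have hU : P.real (⋃ i ∈ (Finset.univ : Finset (Fin R)), {ω | n ω = (i : ℕ) + 1}) = 1 := by
      rw [measureReal_biUnion_finset]
      · simp_rw [hlaw', hp1]
      · intro i _ j _ hij
        refine Set.disjoint_left.2 fun ω h1 h2 => hij (Fin.ext ?_)
        simp only [Set.mem_ofPred_eq] at h1 h2
        omega
      · exact fun i _ => hms _
    have hUm : MeasurableSet (⋃ i ∈ (Finset.univ : Finset (Fin R)), {ω | n ω = (i : ℕ) + 1}) :=
      Finset.measurableSet_biUnion _ fun i _ => hms _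
    have hc := probReal_compl_eq_one_sub (μ := P) hUm
    rw [hU, sub_self] at hc
    refine le_antisymm ?_ measureReal_nonneg
    rw [← hc]
    refine measureReal_mono fun ω hω => ?_
    simp only [Set.mem_ofPred_eq] at hω
    simp only [Set.mem_compl_iff, Set.mem_iUnion, Set.mem_ofPred_eq, not_exists, hω]
    exact fun i _ => h i

/-- Adding an independent summand convolves the laws, which multiplies the generating polynomials.
-/
lemma measureReal_sum_nodes_eq {ι : Type*} {R : ℕ} {p : Fin R → ℝ} (hp : ∀ i, 0 ≤ p i)
    (hp1 : ∑ i, p i = 1) {n : ι → Ω → ℕ} (hn : ∀ i, Measurable (n i))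
    (hlaw : ∀ k, ∀ i : Fin R, P {ω | n k ω = (i : ℕ) + 1} = ENNReal.ofReal (p i))
    (hind : iIndepFun n P) (S : Finset ι) (k : ℕ) :
    P.real {ω | ∑ i ∈ S, n i ω = k} = (nodePoly p ^ S.card).coeff k := by
  classical
  induction S using Finset.induction_on generalizing k with
  | empty =>
    rw [Finset.card_empty, pow_zero, Polynomial.coeff_one]
    by_cases h : k = 0
    · simp [h]
    · simp [h, Ne.symm h]
  | insert i S hi ih =>
    have hS : Measurable fun ω => ∑ j ∈ S, n j ω := Finset.measurable_sum S fun j _ => hn j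
    have hI : IndepFun (n i) (fun ω => ∑ j ∈ S, n j ω) P := by
      have := (hind.indepFun_finsetSum_of_notMem hn hi).symm
      convert! this using 1
      ext ω
      simp
    rw [Finset.card_insert_of_notMem hi, pow_succ', Polynomial.coeff_mul]
    have hset : {ω | ∑ j ∈ insert i S, n j ω = k} = ⋃ x ∈ Finset.HasAntidiagonal.antidiagonal k,
        ({ω | n i ω = x.1} ∩ {ω | ∑ j ∈ S, n j ω = x.2}) := by
      ext ω
      simp only [Finset.sum_insert hi, Set.mem_ofPred_eq, Set.mem_iUnion, Finset.HasAntidiagonal.mem_antidiagonal,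
        Set.mem_inter_iff, exists_prop, Prod.exists]
      constructor
      · exact fun h => ⟨_, _, h, rfl, rfl⟩
      · rintro ⟨_, _, h, rfl, rfl⟩
        exact h
    rw [hset, measureReal_biUnion_finset]
    · refine Finset.sum_congr rfl fun x _ => ?_
      rw [← measureReal_node_eq hp hp1 (hn i) (hlaw i), ← ih, measureReal_def, measureReal_def,
        measureReal_def, ← ENNReal.toReal_mul]
      congr 1
      exact hI.measure_inter_preimage_eq_mul _ _ (measurableSet_singleton x.1)
        (measurableSet_singleton x.2)
    · intro x _ y _ hxy
      refine Set.disjoint_left.2 fun ω h1 h2 => hxy ?_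
      exact Prod.ext (h1.1.symm.trans h2.1) (h1.2.symm.trans h2.2)
    · exact fun x _ => (hn i (measurableSet_singleton x.1)).inter (hS (measurableSet_singleton x.2))

lemma measureReal_sum_nodes_inter {ι : Type*} {R : ℕ} {p : Fin R → ℝ} (hp : ∀ i, 0 ≤ p i)
    (hp1 : ∑ i, p i = 1) {n : ι → Ω → ℕ} (hn : ∀ i, Measurable (n i))
    (hlaw : ∀ k, ∀ i : Fin R, P {ω | n k ω = (i : ℕ) + 1} = ENNReal.ofReal (p i))
    (hind : iIndepFun n P) {S T : Finset ι} (hST : Disjoint S T) (k j : ℕ) :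
    P.real {ω | ∑ i ∈ S, n i ω = k ∧ ∑ i ∈ T, n i ω = j} =
      (nodePoly p ^ S.card).coeff k * (nodePoly p ^ T.card).coeff j := by
  have hI : IndepFun (fun ω => ∑ i ∈ S, n i ω) (fun ω => ∑ i ∈ T, n i ω) P := by
    have := (hind.indepFun_finset S T hST hn).comp (φ := fun x : S → ℕ => ∑ i, x i)
      (ψ := fun x : T → ℕ => ∑ i, x i) (by fun_prop) (by fun_prop)
    convert! this using 1
    · ext ω
      exact (Finset.sum_coe_sort S fun i => n i ω).symm
    · ext ω
      exact (Finset.sum_coe_sort T fun i => n i ω).symm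
  rw [← measureReal_sum_nodes_eq hp hp1 hn hlaw hind, ← measureReal_sum_nodes_eq hp hp1 hn hlaw hind,
    measureReal_def, measureReal_def, measureReal_def, ← ENNReal.toReal_mul]
  congr 1
  exact hI.measure_inter_preimage_eq_mul _ _ (measurableSet_singleton k)
    (measurableSet_singleton j)

/-- The total weight of the nodes lost at the strikes indexed by `S`, as a function of the
marks. -/
def markWeight (S : Finset ℕ) (z : (ℕ → ℕ) × (ℕ × ℕ → ℝ)) : ℝ :=
  ∑ i ∈ S, ∑ l ∈ Finset.range (z.1 i), z.2 (l, i)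

lemma measurable_markWeight (S : Finset ℕ) : Measurable (markWeight S) := by
  refine Finset.measurable_sum S fun i _ => ?_
  have : Measurable fun q : ℕ × (ℕ × ℕ → ℝ) => ∑ l ∈ Finset.range q.1, q.2 (l, i) :=
    measurable_from_prod_countable_right fun m =>
      Finset.measurable_sum (Finset.range m) fun l _ => measurable_pi_apply (l, i)
  have hfst : Measurable fun z : (ℕ → ℕ) × (ℕ × ℕ → ℝ) => (z.1 i, z.2) :=
    ((measurable_pi_apply i).comp measurable_fst).prodMk measurable_snd
  exact this.comp hfst

/-- The truncated Laplace kernel of the weight of the nodes lost at the strikes in `S` and `T`,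
restricted to the event that `k` and `j` nodes are lost at the strikes in `S` and `T`. -/
def markKernel (v : ℂ) (V : ℝ) (k j : ℕ) (S T : Finset ℕ) (z : (ℕ → ℕ) × (ℕ × ℕ → ℝ)) : ℂ :=
  Set.indicator {z | ∑ i ∈ S, z.1 i = k ∧ ∑ i ∈ T, z.1 i = j}
    (fun z => truncExp v V (markWeight (S ∪ T) z)) z

lemma measurableSet_sum_nodes (k j : ℕ) (S T : Finset ℕ) : MeasurableSet
    {z : (ℕ → ℕ) × (ℕ × ℕ → ℝ) | ∑ i ∈ S, z.1 i = k ∧ ∑ i ∈ T, z.1 i = j} := by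
  have h : ∀ S : Finset ℕ, Measurable fun z : (ℕ → ℕ) × (ℕ × ℕ → ℝ) => ∑ i ∈ S, z.1 i :=
    fun S => by fun_prop
  exact (h S (measurableSet_singleton k)).inter (h T (measurableSet_singleton j))

lemma measurable_markKernel (v : ℂ) (V : ℝ) (k j : ℕ) (S T : Finset ℕ) :
    Measurable (markKernel v V k j S T) :=
  ((measurable_truncExp v V).comp (measurable_markWeight _)).indicator
    (measurableSet_sum_nodes k j S T)

lemma norm_markKernel_le {v : ℂ} (hv : 0 ≤ v.re) (V : ℝ) (k j : ℕ) (S T : Finset ℕ)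
    (z : (ℕ → ℕ) × (ℕ × ℕ → ℝ)) : ‖markKernel v V k j S T z‖ ≤ 1 := by
  rw [markKernel, Set.indicator]
  split_ifs
  · exact norm_truncExp_le hv V _
  · simp

/-- With the node counts frozen, the strikes in `S ∪ T` carry exactly `k + j` nodes on the event in
question. The inner integral over the weights is therefore constant there, whatever the individual
counts. -/
lemma integral_markKernel {R : ℕ} {p : Fin R → ℝ} (hp : ∀ i, 0 ≤ p i)
    (hp1 : ∑ i, p i = 1) {n : ℕ → Ω → ℕ} (hn : ∀ i, Measurable (n i))
    (hlaw : ∀ k, ∀ i : Fin R, P {ω | n k ω = (i : ℕ) + 1} = ENNReal.ofReal (p i))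
    (hind : iIndepFun n P) {a r V : ℝ} (ha : 0 < a) (hr : 0 < r) (hV : 0 < V) {v : ℂ}
    (hv : 0 ≤ v.re) {w : ℕ × ℕ → Ω → ℝ} (hw : ∀ i, Measurable (w i))
    (hwlaw : ∀ i, P.map (w i) = gammaMeasure a r) (hwind : iIndepFun w P)
    (hnw : IndepFun (fun ω k => n k ω) (fun ω jk => w jk ω) P)
    {S T : Finset ℕ} (hST : Disjoint S T) (k j : ℕ) :
    ∫ ω, markKernel v V k j S T (fun i => n i ω, fun i => w i ω) ∂P =
      (((nodePoly p ^ S.card).coeff k * (nodePoly p ^ T.card).coeff j : ℝ) : ℂ) *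
        gammaTrunc a r V v (k + j) := by
  rw [integral_comp_of_indepFun (measurable_pi_lambda _ hn) (measurable_pi_lambda _ hw) hnw
    (measurable_markKernel v V k j S T) (norm_markKernel_le hv V k j S T)]
  have hinner : ∀ ω, ∫ ω', markKernel v V k j S T (fun i => n i ω, fun i => w i ω') ∂P =
      Set.indicator {ω | ∑ i ∈ S, n i ω = k ∧ ∑ i ∈ T, n i ω = j}
        (fun _ => gammaTrunc a r V v (k + j)) ω := by
    intro ω
    by_cases h : ∑ i ∈ S, n i ω = k ∧ ∑ i ∈ T, n i ω = j
    · simp only [markKernel, Set.indicator, Set.mem_ofPred_eq, h, and_self, if_true]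
      -- Weights are indexed by (node, strike), whereas the sigma type lists (strike, node).
      let e : (Σ _ : ℕ, ℕ) ↪ ℕ × ℕ :=
        ⟨fun q => (q.2, q.1), fun q q' hq => by
          obtain ⟨a, b⟩ := q; obtain ⟨a', b'⟩ := q'
          simp only [Prod.mk.injEq] at hq
          obtain ⟨rfl, rfl⟩ := hq
          rfl⟩
      have hJ : ∀ ω', markWeight (S ∪ T) (fun i => n i ω, fun i => w i ω') =
          ∑ q ∈ ((S ∪ T).sigma fun i => Finset.range (n i ω)).map e, w q ω' := by
        intro ω'
        rw [Finset.sum_map, Finset.sum_sigma]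
        rfl
      simp_rw [hJ]
      rw [integral_truncExp_sum ha hr hV hv hw hwlaw hwind, Finset.card_map, Finset.card_sigma]
      simp_rw [Finset.card_range]
      rw [Finset.sum_union hST, h.1, h.2]
    · simp [markKernel, Set.indicator, h]
  simp_rw [hinner]
  rw [integral_indicator_const, measureReal_sum_nodes_inter hp hp1 hn hlaw hind hST,
    Complex.real_smul]
  have := measurableSet_sum_nodes k j S T
  have hm : Measurable fun ω => ((fun i => n i ω : ℕ → ℕ), (fun i => w i ω : ℕ × ℕ → ℝ)) :=
    (measurable_pi_lambda _ hn).prodMk (measurable_pi_lambda _ hw)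
  exact hm this

end Marks

/-! ### Strikes in a window -/

section Strikes

/-- The indices of the points of the sequence `s` in `T`, or `∅` if there are infinitely many. -/
def strikes (T : Set ℝ) (s : ℕ → ℝ) : Finset ℕ :=
  open Classical in if h : {k | s k ∈ T}.Finite then h.toFinset else ∅

lemma mem_strikes {T : Set ℝ} {s : ℕ → ℝ} {k : ℕ} :
    k ∈ strikes T s ↔ s k ∈ T ∧ {k | s k ∈ T}.Finite := by
  rw [strikes]
  split_ifs with h <;> simp [h]

lemma disjoint_strikes {T T' : Set ℝ} (h : Disjoint T T') (s : ℕ → ℝ) :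
    Disjoint (strikes T s) (strikes T' s) :=
  Finset.disjoint_left.2 fun _ h1 h2 =>
    Set.disjoint_left.1 h (mem_strikes.1 h1).1 (mem_strikes.1 h2).1

lemma card_strikes (T : Set ℝ) (s : ℕ → ℝ) :
    (strikes T s).card = ({k | s k ∈ T}.encard).toNat := by
  rw [strikes]
  split_ifs with h
  · rw [h.encard_eq_coe_toFinset_card, ENat.toNat_natCast]
  · rw [Set.Infinite.encard_eq h]
    simp

lemma strikes_union {T T' : Set ℝ} {s : ℕ → ℝ} (h : {k | s k ∈ T}.Finite)
    (h' : {k | s k ∈ T'}.Finite) : strikes (T ∪ T') s = strikes T s ∪ strikes T' s := by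
  have hU : {k | s k ∈ T ∪ T'}.Finite := h.union h'
  ext k
  rw [Finset.mem_union, mem_strikes, mem_strikes, mem_strikes]
  exact ⟨fun hk => hk.1.imp (⟨·, h⟩) (⟨·, h'⟩), fun hk => ⟨hk.imp And.left And.left, hU⟩⟩

/-- Finiteness is rephrased as containment in some `F : Finset ℕ`, which leaves only countable
quantifiers. -/
lemma measurable_strikes {T : Set ℝ} (hT : MeasurableSet T) : Measurable (strikes T) := by
  refine measurable_finset_iff.2 fun a => ?_
  have hfin : ∀ s : ℕ → ℝ, {k | s k ∈ T}.Finite ↔ ∃ F : Finset ℕ, ∀ k, s k ∈ T → k ∈ F :=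
    fun s => ⟨fun h => ⟨h.toFinset, fun k hk => by simpa using hk⟩,
      fun ⟨F, hF⟩ => F.finite_toSet.subset hF⟩
  have hmem : ∀ k : ℕ, Measurable fun s : ℕ → ℝ => s k ∈ T := fun k =>
    measurableSet_setOfPred.1 (measurable_pi_apply k hT)
  simp only [mem_strikes, hfin]
  exact (hmem a).and (Measurable.exists fun F => Measurable.forall fun k =>
    (hmem k).imp measurable_const)

end Strikes

/-! ### Compound Poisson law of the losses in disjoint windows -/

section CompoundPoisson

open StrikeNetwork

/-- The probability that a compound Poisson variable of intensity `x`, with summands distributed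
according to `p`, equals `k`. -/
def compoundPoissonMass {R : ℕ} (p : Fin R → ℝ) (x : ℝ) (k : ℕ) : ℝ :=
  Real.exp (-x) * ∑ r ∈ Finset.range ((R - 1) * k / R + 1), x ^ (k - r) * multiSum p k r

variable {Ω : Type*} [MeasurableSpace Ω] {P : Measure Ω} {t : ℕ → Ω → ℝ} {lam : ℝ}

lemma StrikeNetwork.IsPoissonProcess.measurable_pointCount (h : IsPoissonProcess P t lam)
    {T : Set ℝ} (hT : MeasurableSet T) : Measurable (pointCount t T) := by
  refine Measurable.comp measurable_encard (measurable_set_iff.2 fun k => ?_)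
  exact measurableSet_setOfPred.1 (h.measurable k hT)

lemma StrikeNetwork.IsPoissonProcess.measurable_strikes (h : IsPoissonProcess P t lam)
    {T : Set ℝ} (hT : MeasurableSet T) : Measurable fun ω => strikes T fun k => t k ω :=
  (_root_.measurable_strikes hT).comp (measurable_pi_lambda _ h.measurable)

lemma StrikeNetwork.IsPoissonProcess.measurable_card_strikes (h : IsPoissonProcess P t lam)
    {T : Set ℝ} (hT : MeasurableSet T) : Measurable fun ω => (strikes T fun k => t k ω).card :=
  (measurable_of_countable Finset.card).comp (h.measurable_strikes hT)

lemma StrikeNetwork.IsPoissonProcess.indepFun_card_strikes (h : IsPoissonProcess P t lam)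
    {T T' : Set ℝ} (hT : MeasurableSet T) (hT0 : T ⊆ Set.Ici 0)
    (hvol : volume T ≠ ∞) (hT' : MeasurableSet T') (hT0' : T' ⊆ Set.Ici 0)
    (hvol' : volume T' ≠ ∞) (hd : Disjoint T T') :
    IndepFun (fun ω => (strikes T fun k => t k ω).card)
      (fun ω => (strikes T' fun k => t k ω).card) P := by
  have hi := h.indep 2 ![T, T'] (by simp [Fin.forall_fin_two, hT, hT'])
    (by simp only [Fin.forall_fin_two]; exact ⟨hT0, hT0'⟩)
    (by simp only [Fin.forall_fin_two]; exact ⟨hvol, hvol'⟩)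
    (by
      intro i j hij
      fin_cases i <;> fin_cases j
      · exact absurd rfl hij
      · exact hd
      · exact hd.symm
      · exact absurd rfl hij)
  have := (hi.indepFun (show (0 : Fin 2) ≠ 1 by decide)).comp
    (measurable_of_countable ENat.toNat) (measurable_of_countable ENat.toNat)
  convert! this using 1 <;> ext ω <;> exact card_strikes _ _

variable [IsProbabilityMeasure P]

/-- The Poisson probabilities of the finite values sum to 1. -/
lemma StrikeNetwork.IsPoissonProcess.ae_finite (h : IsPoissonProcess P t lam) (hlam : 0 < lam)
    {T : Set ℝ} (hT : MeasurableSet T) (hT0 : T ⊆ Set.Ici 0) (hvol : volume T ≠ ∞) :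
    ∀ᵐ ω ∂P, {k | t k ω ∈ T}.Finite := by
  have hmeas := h.measurable_pointCount hT
  have hU : P (⋃ m : ℕ, {ω | pointCount t T ω = m}) = 1 := by
    rw [measure_iUnion]
    · simp_rw [h.law T hT hT0 hvol]
      have hx : 0 ≤ lam * volume.real T := mul_nonneg hlam.le measureReal_nonneg
      have hs : HasSum (fun m : ℕ => Real.exp (-(lam * volume.real T)) *
          (lam * volume.real T) ^ m / m.factorial) 1 := by
        have := (NormedSpace.expSeries_div_hasSum_exp (lam * volume.real T)).mul_left
          (Real.exp (-(lam * volume.real T)))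
        rw [← Real.exp_eq_exp_ℝ, ← Real.exp_add, neg_add_cancel, Real.exp_zero] at this
        simpa only [mul_div_assoc] using this
      rw [← ENNReal.ofReal_tsum_of_nonneg (fun m => by positivity) hs.summable, hs.tsum_eq,
        ENNReal.ofReal_one]
    · intro i j hij
      refine Set.disjoint_left.2 fun ω h1 h2 => hij ?_
      simp only [Set.mem_ofPred_eq] at h1 h2
      exact_mod_cast h1.symm.trans h2
    · exact fun m => hmeas (measurableSet_singleton _)
  have hUm : MeasurableSet (⋃ m : ℕ, {ω | pointCount t T ω = m}) :=
    MeasurableSet.iUnion fun m => hmeas (measurableSet_singleton _)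
  have hae : ∀ᵐ ω ∂P, ω ∈ ⋃ m : ℕ, {ω | pointCount t T ω = m} :=
    (mem_ae_iff_prob_eq_one hUm).2 hU
  filter_upwards [hae] with ω hω
  obtain ⟨m, hm⟩ := Set.mem_iUnion.1 hω
  refine Set.encard_lt_top_iff.1 ?_
  have : Set.encard {k | t k ω ∈ T} = m := hm
  rw [this]
  exact ENat.natCast_lt_top m

lemma StrikeNetwork.IsPoissonProcess.measureReal_card_strikes (h : IsPoissonProcess P t lam)
    (hlam : 0 < lam) {T : Set ℝ} (hT : MeasurableSet T) (hT0 : T ⊆ Set.Ici 0)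
    (hvol : volume T ≠ ∞) (a : ℕ) :
    P.real {ω | (strikes T fun k => t k ω).card = a} =
      Real.exp (-(lam * volume.real T)) * (lam * volume.real T) ^ a / a.factorial := by
  have hx : 0 ≤ lam * volume.real T := mul_nonneg hlam.le measureReal_nonneg
  rw [measureReal_def, ← ENNReal.toReal_ofReal (r := _ / _) (by positivity),
    ← h.law T hT hT0 hvol a]
  congr 1
  refine measure_congr ?_
  filter_upwards [h.ae_finite hlam hT hT0 hvol] with ω hω
  refine propext ?_
  change (strikes T fun k => t k ω).card = a ↔ Set.encard {k | t k ω ∈ T} = a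
  rw [card_strikes, hω.encard_eq_coe_toFinset_card, ENat.toNat_natCast]
  exact ENat.natCast_inj.symm

lemma StrikeNetwork.IsPoissonProcess.integral_coeff_card_strikes (h : IsPoissonProcess P t lam)
    (hlam : 0 < lam) {T : Set ℝ} (hT : MeasurableSet T) (hT0 : T ⊆ Set.Ici 0)
    (hvol : volume T ≠ ∞) {R : ℕ} (hR : 0 < R) {p : Fin R → ℝ} {C : ℝ} {k : ℕ}
    (hC : ∀ a, ‖(nodePoly p ^ a).coeff k‖ ≤ C) :
    ∫ ω, (nodePoly p ^ (strikes T fun k => t k ω).card).coeff k ∂P =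
      compoundPoissonMass p (lam * volume.real T) k := by
  have hm := h.measurable_card_strikes hT
  have := Measure.isProbabilityMeasure_map (μ := P) hm.aemeasurable
  have hmap := integral_map (μ := P) hm.aemeasurable
    (f := fun a => (nodePoly p ^ a).coeff k) (measurable_of_countable _).aestronglyMeasurable
  rw [← hmap, integral_countable (Integrable.of_bound
    (measurable_of_countable _).aestronglyMeasurable C (Filter.Eventually.of_forall hC))]
  have hterm : ∀ a, (P.map fun ω => (strikes T fun k => t k ω).card).real {a} •
      (nodePoly p ^ a).coeff k = Real.exp (-(lam * volume.real T)) *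
        ((lam * volume.real T) ^ a / a.factorial * (nodePoly p ^ a).coeff k) := by
    intro a
    rw [map_measureReal_apply hm (measurableSet_singleton a)]
    change P.real {ω | (strikes T fun k => t k ω).card = a} • _ = _
    rw [h.measureReal_card_strikes hlam hT hT0 hvol, smul_eq_mul]
    ring
  simp_rw [hterm]
  exact ((hasSum_pow_div_factorial_mul_coeff p hR _ k).mul_left _).tsum_eq

variable {n : ℕ → Ω → ℕ} {w : ℕ → ℕ → Ω → ℝ} {τ : ℕ → Ω → ℝ} {c α ξ : ℝ} {R : ℕ} {p : Fin R → ℝ}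

/-- Strike times are independent of the marks, so the strike sets can be frozen. What is left
depends on them only through their cardinalities, which are independent for disjoint windows. -/
lemma StrikeNetwork.IsConstantObservationModel.integral_markKernel_strikes
    (hmodel : IsConstantObservationModel P t n w τ lam c α ξ p) (hlam : 0 < lam)
    (hα : 0 < α) (hξ : 0 < ξ) (hp : ∀ i, 0 ≤ p i) (hp1 : ∑ i, p i = 1) {V : ℝ} (hV : 0 < V)
    {v : ℂ} (hv : 0 ≤ v.re)
    {T T' : Set ℝ} (hT : MeasurableSet T) (hT0 : T ⊆ Set.Ici 0)
    (hvol : volume T ≠ ∞) (hT' : MeasurableSet T') (hT0' : T' ⊆ Set.Ici 0)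
    (hvol' : volume T' ≠ ∞) (hd : Disjoint T T') (k j : ℕ) :
    ∫ ω, markKernel v V k j (strikes T fun i => t i ω) (strikes T' fun i => t i ω)
        (fun i => n i ω, fun jk => w jk.1 jk.2 ω) ∂P =
      ((compoundPoissonMass p (lam * volume.real T) k *
        compoundPoissonMass p (lam * volume.real T') j : ℝ) : ℂ) *
          gammaTrunc α ξ V v (k + j) := by
  have hR : 0 < R := by
    rcases Nat.eq_zero_or_pos R with rfl | h
    · simp at hp1
    · exact h
  -- Each coefficient is the probability that `a` strikes destroy `k` nodes.
  have hcoeff : ∀ k a, ‖(nodePoly p ^ a).coeff k‖ ≤ 1 := by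
    intro k a
    rw [Real.norm_of_nonneg (coeff_nodePoly_nonneg hp a k), ← Finset.card_range a,
      ← measureReal_sum_nodes_eq hp hp1 hmodel.measurable_nodes hmodel.law_nodes
        hmodel.indep_nodes]
    exact measureReal_le_one
  have hw : ∀ jk : ℕ × ℕ, Measurable (w jk.1 jk.2) := fun jk => hmodel.measurable_weight _ _
  have hX : Measurable fun ω => ((strikes T fun i => t i ω), (strikes T' fun i => t i ω)) :=
    (hmodel.poisson.measurable_strikes hT).prodMk (hmodel.poisson.measurable_strikes hT')
  have hY : Measurable fun ω => ((fun i => n i ω : ℕ → ℕ),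
      (fun jk => w jk.1 jk.2 ω : ℕ × ℕ → ℝ)) :=
    (measurable_pi_lambda _ hmodel.measurable_nodes).prodMk (measurable_pi_lambda _ hw)
  have hXY := hmodel.indep_times_marks.comp
    ((measurable_strikes hT).prodMk (measurable_strikes hT')) measurable_id
  have hf : Measurable fun z : (Finset ℕ × Finset ℕ) × ((ℕ → ℕ) × (ℕ × ℕ → ℝ)) =>
      markKernel v V k j z.1.1 z.1.2 z.2 :=
    measurable_from_prod_countable_right fun x => measurable_markKernel v V k j x.1 x.2
  have h1 := integral_comp_of_indepFun hX hY hXY hf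
    (fun z => norm_markKernel_le hv V k j z.1.1 z.1.2 z.2)
  dsimp only at h1
  rw [h1]
  simp_rw [integral_markKernel hp hp1 hmodel.measurable_nodes hmodel.law_nodes
    hmodel.indep_nodes hα hξ hV hv hw (fun jk => hmodel.law_weight _ _) hmodel.indep_weight
    hmodel.indep_nodes_weight (disjoint_strikes hd _) k j]
  rw [integral_mul_const, integral_complex_ofReal]
  congr 2
  have h2 := (hmodel.poisson.indepFun_card_strikes hT hT0 hvol hT' hT0' hvol' hd).comp
    (measurable_of_countable fun a => (nodePoly p ^ a).coeff k)
    (measurable_of_countable fun a => (nodePoly p ^ a).coeff j)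
  rw [← hmodel.poisson.integral_coeff_card_strikes hlam hT hT0 hvol hR (hcoeff k),
    ← hmodel.poisson.integral_coeff_card_strikes hlam hT' hT0' hvol' hR (hcoeff j)]
  refine h2.integral_fun_mul_eq_mul_integral ?_ ?_
  · exact ((measurable_of_countable _).comp
      (hmodel.poisson.measurable_card_strikes hT)).aestronglyMeasurable
  · exact ((measurable_of_countable _).comp
      (hmodel.poisson.measurable_card_strikes hT')).aestronglyMeasurable

end CompoundPoisson

/-! ### Series over the observation epochs -/

section Series

open StrikeNetwork

/-- `polylog` starts at exponent 1; the missing term `m = 0` equals `0 ^ d`, which is 1 exactly when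
`d = 0`. -/
lemma hasSum_pow_mul_pow_polylog {z : ℂ} (hz : ‖z‖ < 1) (d : ℕ) :
    HasSum (fun m : ℕ => z ^ m * (m : ℂ) ^ d) ((if d = 0 then 1 else 0) + polylog (-(d : ℤ)) z) := by
  have hs : Summable fun m : ℕ => z ^ m * (m : ℂ) ^ d := by
    simpa only [mul_comm] using summable_pow_mul_geometric_of_norm_lt_one d hz
  have hp : polylog (-(d : ℤ)) z = ∑' m : ℕ, z ^ (m + 1) * ((m + 1 : ℕ) : ℂ) ^ d := by
    simp [polylog]
  have h0 : (if d = 0 then (1 : ℂ) else 0) = z ^ 0 * ((0 : ℕ) : ℂ) ^ d := by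
    split_ifs with h <;> simp [h]
  rw [hp, h0, ← hs.tsum_eq_zero_add]
  exact hs.hasSum

/-- For `k > 0` the range forces `r < k`, so `k - r = 0` occurs only at `k = 0`. The `m = 0`
corrections thus add up to the summand `1` of `coeffF` at `j = 0`. -/
lemma sum_multiSum_ite {R : ℕ} (hR : 0 < R) (p : Fin R → ℝ) (x : ℂ) (k : ℕ) :
    ∑ r ∈ Finset.range ((R - 1) * k / R + 1),
      x ^ (k - r) * (if k - r = 0 then 1 else 0) * (multiSum p k r : ℂ) =
        if k = 0 then 1 else 0 := by
  rcases Nat.eq_zero_or_pos k with rfl | hk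
  · have h : multiSum p 0 0 = 1 := by
      have := coeff_nodePoly_pow p 0 0
      simp only [pow_zero, Polynomial.coeff_one_zero, Nat.factorial_zero, Nat.cast_one,
        one_mul] at this
      exact this.symm
    simp [h]
  · rw [if_neg hk.ne']
    refine Finset.sum_eq_zero fun r hr => ?_
    have h1 : r ≤ (R - 1) * k / R := Nat.lt_succ_iff.1 (Finset.mem_range.1 hr)
    have h2 : (R - 1) * k / R < k := by
      rw [Nat.div_lt_iff_lt_mul hR, mul_comm k]
      exact Nat.mul_lt_mul_of_pos_right (by omega) hk
    rw [if_neg (by omega)]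
    ring

/-- The exponentials combine to `e^{-cθ} z^m` with `z = e^{-c(θ+λ)}`, and the mass supplies a
polynomial in `m`. Convergence uses `‖z‖ < 1`, which holds since `λ > 0`. -/
lemma hasSum_compoundPoissonMass {R : ℕ} (hR : 0 < R) (p : Fin R → ℝ) {c lam : ℝ} (hc : 0 < c)
    (hlam : 0 < lam) {θ : ℂ} (hθ : 0 ≤ θ.re) (k : ℕ) :
    HasSum (fun m : ℕ => Complex.exp (-(θ * (c * ((m : ℂ) + 1)))) *
      (compoundPoissonMass p (lam * (c * m)) k : ℂ))
      (Complex.exp (-(c * θ)) * coeffF c lam p θ k) := by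
  set z : ℂ := Complex.exp (-(c * (θ + lam))) with hz
  have hz1 : ‖z‖ < 1 := by
    rw [hz, Complex.norm_exp, Real.exp_lt_one_iff]
    have : 0 < c * (θ.re + lam) := mul_pos hc (by linarith)
    simpa using this
  have hterm : ∀ m : ℕ, Complex.exp (-(θ * (c * ((m : ℂ) + 1)))) *
      (compoundPoissonMass p (lam * (c * m)) k : ℂ) = Complex.exp (-(c * θ)) *
        ∑ r ∈ Finset.range ((R - 1) * k / R + 1), ((c * lam : ℝ) : ℂ) ^ (k - r) *
          (z ^ m * (m : ℂ) ^ (k - r)) * (multiSum p k r : ℂ) := by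
    intro m
    have hexp : Complex.exp (-(θ * (c * ((m : ℂ) + 1)))) * Complex.exp (-(lam * (c * m))) =
        Complex.exp (-(c * θ)) * z ^ m := by
      rw [hz, ← Complex.exp_nat_mul, ← Complex.exp_add, ← Complex.exp_add]
      ring_nf
    rw [compoundPoissonMass]
    push_cast
    rw [← mul_assoc, hexp, mul_assoc, Finset.mul_sum]
    congr 1
    refine Finset.sum_congr rfl fun r _ => ?_
    rw [show (lam : ℂ) * (c * m) = (c * lam) * m by ring, mul_pow _ (m : ℂ)]
    ring
  simp_rw [hterm]
  refine HasSum.mul_left _ ?_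
  have := hasSum_sum (s := Finset.range ((R - 1) * k / R + 1)) fun r _ =>
    ((hasSum_pow_mul_pow_polylog hz1 (k - r)).mul_left
      (((c * lam : ℝ) : ℂ) ^ (k - r))).mul_right (multiSum p k r : ℂ)
  convert! this using 1
  rw [coeffF, ← sum_multiSum_ite hR p ((c * lam : ℝ) : ℂ) k, ← Finset.sum_add_distrib]
  refine Finset.sum_congr rfl fun r _ => ?_
  ring

lemma compoundPoissonMass_eq_coeffE {R : ℕ} (p : Fin R → ℝ) (c lam : ℝ) (k : ℕ) :
    compoundPoissonMass p (lam * c) k = Real.exp (-(lam * c)) * coeffE c lam p k := by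
  rw [compoundPoissonMass, coeffE, mul_comm lam c]

/-- Splitting a sum over `k ≤ a < k + m ≤ b` into a full sum and a Cauchy product. -/
lemma sum_filter_lt_add {A : Type*} [CommRing A] {a b : ℕ} (hab : a < b) (F E G : ℕ → A) :
    ∑ k ∈ Finset.range (a + 1), ∑ m ∈ (Finset.range (b - k + 1)).filter (fun m => a < k + m),
        F k * E m * G (k + m) =
      ∑ k ∈ Finset.range (a + 1), F k * ∑ m ∈ Finset.range (b - k + 1), E m * G (k + m) -
      ∑ s ∈ Finset.range (a + 1), G s * ∑ i ∈ Finset.range (s + 1), E i * F (s - i) := by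
  have h1 : ∀ k ∈ Finset.range (a + 1),
      ∑ m ∈ (Finset.range (b - k + 1)).filter (fun m => a < k + m), F k * E m * G (k + m) =
      F k * ∑ m ∈ Finset.range (b - k + 1), E m * G (k + m) -
        ∑ m ∈ Finset.range (a - k + 1), F k * E m * G (k + m) := by
    intro k hk
    rw [Finset.mem_range] at hk
    rw [Finset.mul_sum, eq_sub_iff_add_eq, ← Finset.sum_filter_add_sum_filter_not
      (Finset.range (b - k + 1)) (fun m => a < k + m)]
    simp only [mul_assoc]
    congr 1
    refine Finset.sum_congr ?_ fun _ _ => rfl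
    ext m
    simp only [Finset.mem_range, Finset.mem_filter]
    omega
  rw [Finset.sum_congr rfl h1, Finset.sum_sub_distrib]
  congr 1
  simp_rw [Finset.mul_sum]
  rw [Finset.sum_sigma', Finset.sum_sigma']
  -- The triangle `k + m ≤ a` is reindexed by `s = k + m`, keeping `m`.
  refine Finset.sum_nbij' (fun q => ⟨q.1 + q.2, q.2⟩) (fun q => ⟨q.1 - q.2, q.2⟩) ?_ ?_ ?_ ?_ ?_
  · rintro ⟨k, m⟩ h
    simp only [Finset.mem_sigma, Finset.mem_range] at h ⊢
    omega
  · rintro ⟨k, m⟩ h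
    simp only [Finset.mem_sigma, Finset.mem_range] at h ⊢
    omega
  · rintro ⟨k, m⟩ h
    simp
  · rintro ⟨k, m⟩ h
    simp only [Finset.mem_sigma, Finset.mem_range] at h
    simp only [Sigma.mk.injEq, heq_eq_eq, and_true]
    omega
  · rintro ⟨k, m⟩ h
    simp only [Nat.add_sub_cancel]
    ring

/-- Only the pair of actual losses `(x, y)` can contribute; this collapses the double sum of kernels
to the exit event on a given path. -/
lemma sum_filter_lt_add_ite {A : Type*} [CommRing A] {a b : ℕ} (hab : a < b) (f : ℕ → ℕ → A)
    (x y : ℕ) (g : A) :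
    ∑ k ∈ Finset.range (a + 1), ∑ m ∈ (Finset.range (b - k + 1)).filter (fun m => a < k + m),
        f k m * (if x = k ∧ y = m then g else 0) =
      if x ≤ a ∧ a < x + y ∧ x + y ≤ b then f x y * g else 0 := by
  split_ifs with h
  · rw [Finset.sum_eq_single x, Finset.sum_eq_single y]
    · simp
    · intro m _ hm
      simp [hm.symm]
    · intro hy
      simp only [Finset.mem_filter, Finset.mem_range] at hy
      omega
    · intro k _ hk
      simp [hk.symm]
    · intro hx
      simp only [Finset.mem_range] at hx
      omega
  · refine Finset.sum_eq_zero fun k hk => Finset.sum_eq_zero fun m hm => ?_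
    simp only [Finset.mem_filter, Finset.mem_range] at hk hm
    rw [if_neg, mul_zero]
    rintro ⟨rfl, rfl⟩
    exact h (by omega)

end Series

/-! ### Exit indices -/

section Exit

open StrikeNetwork

lemma coe_lt_exitIndex_iff {β : Type*} [LT β] {S : ℕ → β} {b : β} {m : ℕ} :
    (m : ℕ∞) < exitIndex S b ↔ ∀ i ≤ m, ¬ b < S i := by
  constructor
  · intro h i hi hb
    have h1 : exitIndex S b ≤ (i : ℕ∞) := iInf₂_le i hb
    exact absurd (h.trans_le h1) (not_lt.2 (by exact_mod_cast hi))
  · intro h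
    have h1 : ((m + 1 : ℕ) : ℕ∞) ≤ exitIndex S b := le_iInf₂ fun i hi => by
      have : m < i := not_le.1 fun hle => h i hle hi
      exact_mod_cast this
    exact lt_of_lt_of_le (by exact_mod_cast Nat.lt_succ_self m) h1

lemma coe_lt_exitIndex_iff_of_monotone {β : Type*} [LinearOrder β] {S : ℕ → β} (hS : Monotone S)
    {b : β} {m : ℕ} : (m : ℕ∞) < exitIndex S b ↔ S m ≤ b := by
  rw [coe_lt_exitIndex_iff]
  exact ⟨fun h => not_lt.1 (h m le_rfl), fun h i hi => not_lt.2 ((hS hi).trans h)⟩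

lemma exitIndex_eq_of_monotone {β : Type*} [LinearOrder β] {S : ℕ → β} (hS : Monotone S)
    {b : β} {m : ℕ} (h1 : S m ≤ b) (h2 : b < S (m + 1)) :
    exitIndex S b = ((m + 1 : ℕ) : ℕ∞) := by
  refine le_antisymm (iInf₂_le (m + 1) h2) ?_
  have := (coe_lt_exitIndex_iff_of_monotone hS).2 h1
  push_cast
  exact Order.add_one_le_of_lt this

/-- The contribution of the epoch `m + 1` to the functional of the exit. -/
def exitTerm (u v θ : ℂ) (V : ℝ) (M₁ M : ℕ) (N : ℕ → ℕ) (W τ : ℕ → ℝ) (m : ℕ) : ℂ :=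
  if N m ≤ M₁ ∧ M₁ < N (m + 1) ∧ N (m + 1) ≤ M ∧ W (m + 1) ≤ V then
    u ^ N (m + 1) * Complex.exp (-(v * (W (m + 1) : ℂ))) * Complex.exp (-(θ * (τ (m + 1) : ℂ)))
  else 0

lemma norm_exitTerm_le {u v θ : ℂ} (hu : ‖u‖ ≤ 1) (hv : 0 ≤ v.re) (hθ : 0 ≤ θ.re) (V : ℝ)
    (M₁ M : ℕ) (N : ℕ → ℕ) {W τ : ℕ → ℝ} (hW : ∀ m, 0 ≤ W m) (hτ : ∀ m, 0 ≤ τ m) (m : ℕ) :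
    ‖exitTerm u v θ V M₁ M N W τ m‖ ≤ 1 := by
  have hexp : ∀ {a : ℂ} {x : ℝ}, 0 ≤ a.re → 0 ≤ x → ‖Complex.exp (-(a * (x : ℂ)))‖ ≤ 1 := by
    intro a x ha hx
    rw [Complex.norm_exp, Real.exp_le_one_iff]
    simpa using mul_nonneg ha hx
  rw [exitTerm]
  split_ifs
  · rw [norm_mul, norm_mul, norm_pow]
    exact mul_le_one₀ (mul_le_one₀ (pow_le_one₀ (norm_nonneg _) hu) (norm_nonneg _)
      (hexp hv (hW _))) (norm_nonneg _) (hexp hθ (hτ _))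
  · simp

/-- A monotone sequence crosses `M₁` at most once. If it never does, all terms vanish and any `m`
serves. -/
lemma exists_exitTerm {u v θ : ℂ} {V : ℝ} {M₁ M : ℕ} {N : ℕ → ℕ} {W : ℕ → ℝ} (τ : ℕ → ℝ)
    (hN : Monotone N) (hN0 : N 0 = 0) (hW : Monotone W) {m₁ : ℕ∞} (hm₁ : m₁ = exitIndex N M₁) :
    ∃ m, (∀ m' ≠ m, exitTerm u v θ V M₁ M N W τ m' = 0) ∧
      exitTerm u v θ V M₁ M N W τ m =
        if m₁ < min (exitIndex N M) (exitIndex W V) then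
          u ^ N m₁.toNat * Complex.exp (-(v * (W m₁.toNat : ℂ))) *
            Complex.exp (-(θ * (τ m₁.toNat : ℂ)))
        else 0 := by
  classical
  by_cases h : ∃ m, M₁ < N m
  -- `N 0 = 0` rules out an exit at the initial observation.
  · obtain ⟨m, hm⟩ : ∃ m, Nat.find h = m + 1 := by
      refine Nat.exists_eq_succ_of_ne_zero fun h0 => ?_
      have := Nat.find_spec h
      rw [h0, hN0] at this
      omega
    have h2 : M₁ < N (m + 1) := hm ▸ Nat.find_spec h
    have h1 : N m ≤ M₁ := not_lt.1 (Nat.find_min h (by omega))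
    have hexit : m₁ = ((m + 1 : ℕ) : ℕ∞) := hm₁.trans (exitIndex_eq_of_monotone hN h1 h2)
    refine ⟨m, fun m' hm' => ?_, ?_⟩
    · rw [exitTerm, if_neg]
      rintro ⟨h3, h4, -⟩
      rcases lt_or_gt_of_ne hm' with hlt | hlt
      · have := hN (show m' + 1 ≤ m from hlt)
        omega
      · have := hN (show m + 1 ≤ m' from hlt)
        omega
    · have hiff : ((m + 1 : ℕ) : ℕ∞) < min (exitIndex N M) (exitIndex W V) ↔
          N (m + 1) ≤ M ∧ W (m + 1) ≤ V := by
        rw [lt_min_iff, coe_lt_exitIndex_iff_of_monotone hN, coe_lt_exitIndex_iff_of_monotone hW]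
      rw [hexit, ENat.toNat_natCast, exitTerm]
      simp only [h1, h2, true_and, hiff]
  · push Not at h
    have htop : m₁ = ⊤ := by
      rw [hm₁, exitIndex, iInf₂_eq_top]
      exact fun i hi => absurd hi (not_lt.2 (h i))
    have hz : ∀ m, exitTerm u v θ V M₁ M N W τ m = 0 := fun m => by
      rw [exitTerm, if_neg]
      rintro ⟨-, h4, -⟩
      exact absurd h4 (not_lt.2 (h _))
    refine ⟨0, fun m _ => hz m, ?_⟩
    -- An infinite index is below nothing, so the default value of `toNat` at `⊤` never enters.
    rw [hz, htop, if_neg not_top_lt]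

end Exit

/-! ### Observed losses along a sample path -/

section Paths

open StrikeNetwork

variable {Ω : Type*} {t : ℕ → Ω → ℝ} {n : ℕ → Ω → ℕ} {w : ℕ → ℕ → Ω → ℝ} {τ : ℕ → Ω → ℝ}

lemma nodesIn_eq_sum_strikes {T : Set ℝ} {ω : Ω} (h : {k | t k ω ∈ T}.Finite) :
    nodesIn t n T ω = ∑ i ∈ strikes T (fun k => t k ω), n i ω := by
  rw [nodesIn, tsum_eq_sum (s := strikes T fun k => t k ω)]
  · exact Finset.sum_congr rfl fun i hi => Set.indicator_of_mem (mem_strikes.1 hi).1 _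
  · exact fun i hi => Set.indicator_of_notMem (fun hi' => hi (mem_strikes.2 ⟨hi', h⟩)) _

lemma weightIn_eq_markWeight {T : Set ℝ} {ω : Ω} (h : {k | t k ω ∈ T}.Finite) :
    weightIn t n w T ω = markWeight (strikes T fun k => t k ω)
      (fun i => n i ω, fun jk => w jk.1 jk.2 ω) := by
  rw [weightIn, tsum_eq_sum (s := strikes T fun k => t k ω)]
  · exact Finset.sum_congr rfl fun i hi => Set.indicator_of_mem (mem_strikes.1 hi).1 _
  · exact fun i hi => Set.indicator_of_notMem (fun hi' => hi (mem_strikes.2 ⟨hi', h⟩)) _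

lemma markWeight_union {S T : Finset ℕ} (h : Disjoint S T) (z : (ℕ → ℕ) × (ℕ × ℕ → ℝ)) :
    markWeight (S ∪ T) z = markWeight S z + markWeight T z :=
  Finset.sum_union h

/-- The properties, valid almost surely, of the sample paths that are used below. -/
structure IsRegularPath (t : ℕ → Ω → ℝ) (w : ℕ → ℕ → Ω → ℝ) (τ : ℕ → Ω → ℝ) (c : ℝ) (ω : Ω) :
    Prop where
  obs : ∀ m : ℕ, τ m ω = c * m
  no_strike_zero : ∀ k, t k ω ≠ 0
  finite : ∀ m : ℕ, {k | t k ω ∈ Set.Ioc 0 (c * m)}.Finite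
  weight_nonneg : ∀ j k, 0 ≤ w j k ω

/-- The strikes up to the `m`-th observation. -/
def strikesUpTo (t : ℕ → Ω → ℝ) (c : ℝ) (m : ℕ) (ω : Ω) : Finset ℕ :=
  strikes (Set.Ioc 0 (c * m)) fun k => t k ω

/-- The strikes between the `m`-th and the `(m+1)`-st observation. -/
def strikesBetween (t : ℕ → Ω → ℝ) (c : ℝ) (m : ℕ) (ω : Ω) : Finset ℕ :=
  strikes (Set.Ioc (c * m) (c * (m + 1))) fun k => t k ω

lemma disjoint_Ioc_epochs (c : ℝ) (m : ℕ) :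
    Disjoint (Set.Ioc 0 (c * m)) (Set.Ioc (c * m) (c * (m + 1))) :=
  Set.disjoint_left.2 fun _ h1 h2 => absurd h2.1 (not_lt.2 h1.2)

lemma disjoint_strikesUpTo (c : ℝ) (m : ℕ) (ω : Ω) :
    Disjoint (strikesUpTo t c m ω) (strikesBetween t c m ω) :=
  disjoint_strikes (disjoint_Ioc_epochs c m) _

namespace IsRegularPath

variable {c : ℝ} {ω : Ω}

lemma finite_between (h : IsRegularPath t w τ c ω) (hc : 0 < c) (m : ℕ) :
    {k | t k ω ∈ Set.Ioc (c * m) (c * (m + 1))}.Finite := by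
  refine (h.finite (m + 1)).subset fun k hk => ?_
  have h0 : 0 ≤ c * m := by positivity
  exact ⟨h0.trans_lt hk.1, by simpa using hk.2⟩

lemma strikesUpTo_succ (h : IsRegularPath t w τ c ω) (hc : 0 < c) (m : ℕ) :
    strikesUpTo t c (m + 1) ω = strikesUpTo t c m ω ∪ strikesBetween t c m ω := by
  rw [strikesUpTo, strikesUpTo, strikesBetween, ← strikes_union (h.finite m)
    (h.finite_between hc m), Set.Ioc_union_Ioc_eq_Ioc (by positivity)]
  · push_cast
    rfl
  · exact mul_le_mul_of_nonneg_left (by linarith) hc.le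

lemma strikesUpTo_zero (c : ℝ) (ω : Ω) : strikesUpTo t c 0 ω = ∅ := by
  ext k
  simp [strikesUpTo, mem_strikes]

lemma setOf_mem_window_zero (h : IsRegularPath t w τ c ω) :
    {k | t k ω ∈ window τ ω 0} = ∅ := by
  have h0 : τ 0 ω = 0 := by simpa using h.obs 0
  ext k
  simp [window, h0, h.no_strike_zero k]

lemma window_succ (h : IsRegularPath t w τ c ω) (m : ℕ) :
    window τ ω (m + 1) = Set.Ioc (c * m) (c * (m + 1)) := by
  simp [window, h.obs]

lemma strikes_window_zero (h : IsRegularPath t w τ c ω) :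
    strikes (window τ ω 0) (fun k => t k ω) = ∅ := by
  ext k
  simp only [mem_strikes, Finset.notMem_empty, iff_false, not_and]
  intro hk
  have : k ∈ {k | t k ω ∈ window τ ω 0} := hk
  rw [h.setOf_mem_window_zero] at this
  exact absurd this (Set.notMem_empty k)

/-- The initial window is `{0}` and holds no strike on a regular path, so the later windows tile
`(0, cm]`. -/
lemma observedNodes_eq (h : IsRegularPath t w τ c ω) (hc : 0 < c) (m : ℕ) :
    observedNodes t n τ m ω = ∑ i ∈ strikesUpTo t c m ω, n i ω := by
  induction m with
  | zero =>
    rw [observedNodes, Finset.sum_range_one, nodesIn_eq_sum_strikes, h.strikes_window_zero,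
      strikesUpTo_zero]
    rw [h.setOf_mem_window_zero]
    exact Set.finite_empty
  | succ m ih =>
    have hs : observedNodes t n τ (m + 1) ω =
        observedNodes t n τ m ω + nodesIn t n (window τ ω (m + 1)) ω := Finset.sum_range_succ _ _
    rw [hs, ih, h.window_succ, nodesIn_eq_sum_strikes (h.finite_between hc m),
      h.strikesUpTo_succ hc, Finset.sum_union (disjoint_strikesUpTo c m ω)]
    rfl

lemma observedWeight_eq (h : IsRegularPath t w τ c ω) (hc : 0 < c) (m : ℕ) :
    observedWeight t n w τ m ω = markWeight (strikesUpTo t c m ω)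
      (fun i => n i ω, fun jk => w jk.1 jk.2 ω) := by
  induction m with
  | zero =>
    rw [observedWeight, Finset.sum_range_one, weightIn_eq_markWeight, h.strikes_window_zero,
      strikesUpTo_zero]
    rw [h.setOf_mem_window_zero]
    exact Set.finite_empty
  | succ m ih =>
    have hs : observedWeight t n w τ (m + 1) ω =
        observedWeight t n w τ m ω + weightIn t n w (window τ ω (m + 1)) ω :=
      Finset.sum_range_succ _ _
    rw [hs, ih, h.window_succ, weightIn_eq_markWeight (h.finite_between hc m),
      h.strikesUpTo_succ hc, markWeight_union (disjoint_strikesUpTo c m ω)]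
    rfl

lemma markWeight_nonneg (h : IsRegularPath t w τ c ω) (S : Finset ℕ) :
    0 ≤ markWeight S (fun i => n i ω, fun jk => w jk.1 jk.2 ω) :=
  Finset.sum_nonneg fun _ _ => Finset.sum_nonneg fun _ _ => h.weight_nonneg _ _

lemma monotone_observedNodes (ω : Ω) : Monotone fun m => observedNodes t n τ m ω :=
  monotone_nat_of_le_succ fun m => by
    simp only [observedNodes, Finset.sum_range_succ _ (m + 1)]
    exact Nat.le_add_right _ _

lemma monotone_observedWeight (h : IsRegularPath t w τ c ω) (hc : 0 < c) :
    Monotone fun m => observedWeight t n w τ m ω :=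
  monotone_nat_of_le_succ fun m => by
    simp only [h.observedWeight_eq hc, h.strikesUpTo_succ hc,
      markWeight_union (disjoint_strikesUpTo c m ω)]
    exact le_add_of_nonneg_right (h.markWeight_nonneg _)

/-- The exit contribution of an epoch as a finite combination of kernels of the marks. -/
lemma exitTerm_eq_sum_markKernel (h : IsRegularPath t w τ c ω) (hc : 0 < c) {M₁ M : ℕ}
    (hM : M₁ < M) (u v θ : ℂ) (V : ℝ) (m : ℕ) :
    exitTerm u v θ V M₁ M (fun m => observedNodes t n τ m ω)
        (fun m => observedWeight t n w τ m ω) (fun m => τ m ω) m =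
      ∑ k ∈ Finset.range (M₁ + 1),
        ∑ j ∈ (Finset.range (M - k + 1)).filter (fun j => M₁ < k + j),
          u ^ (k + j) * Complex.exp (-(θ * (c * ((m : ℂ) + 1)))) *
            markKernel v V k j (strikesUpTo t c m ω) (strikesBetween t c m ω)
              (fun i => n i ω, fun jk => w jk.1 jk.2 ω) := by
  simp only [markKernel, Set.indicator, Set.mem_ofPred_eq]
  rw [sum_filter_lt_add_ite hM
    (fun k j => u ^ (k + j) * Complex.exp (-(θ * (c * ((m : ℂ) + 1))))), ← h.strikesUpTo_succ hc,
    ← Finset.sum_union (disjoint_strikesUpTo c m ω), ← h.strikesUpTo_succ hc,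
    ← h.observedNodes_eq hc, ← h.observedNodes_eq hc, ← h.observedWeight_eq hc, exitTerm, h.obs]
  -- Nonnegativity makes the lower cutoff in `truncExp` harmless.
  have h0 : 0 ≤ observedWeight t n w τ (m + 1) ω := by
    rw [h.observedWeight_eq hc]
    exact h.markWeight_nonneg _
  by_cases hV : observedWeight t n w τ (m + 1) ω ≤ V
  · simp only [truncExp, Set.indicator, Set.mem_Icc, h0, hV, and_true, if_true]
    push_cast
    congr 1
    ring
  · simp [truncExp, Set.indicator, hV]

end IsRegularPath

lemma StrikeNetwork.IsConstantObservationModel.ae_isRegularPath [MeasurableSpace Ω]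
    {P : Measure Ω} [IsProbabilityMeasure P] {lam c α ξ : ℝ} {R : ℕ} {p : Fin R → ℝ}
    (hmodel : IsConstantObservationModel P t n w τ lam c α ξ p) (hlam : 0 < lam) :
    ∀ᵐ ω ∂P, IsRegularPath t w τ c ω := by
  have hfin : ∀ᵐ ω ∂P, ∀ m : ℕ, {k | t k ω ∈ Set.Ioc 0 (c * m)}.Finite :=
    ae_all_iff.2 fun m => hmodel.poisson.ae_finite hlam measurableSet_Ioc
      (fun x hx => hx.1.le) (by simp)
  have hw : ∀ᵐ ω ∂P, ∀ j k, 0 ≤ w j k ω := ae_all_iff.2 fun j => ae_all_iff.2 fun k =>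
    ae_nonneg_of_map_eq_gammaMeasure (hmodel.measurable_weight j k) (hmodel.law_weight j k)
  -- The set `{0}` is Lebesgue null, so its count is Poisson with parameter 0.
  have hzero : ∀ᵐ ω ∂P, pointCount t {0} ω = ((0 : ℕ) : ℕ∞) := by
    have hlaw := hmodel.poisson.law {0} (measurableSet_singleton 0) (by simp) (by simp) 0
    simp only [Measure.real, Real.volume_singleton, ENNReal.toReal_zero, mul_zero, neg_zero,
      Real.exp_zero, pow_zero, mul_one, Nat.factorial_zero, Nat.cast_one, div_one,
      ENNReal.ofReal_one] at hlaw
    exact (mem_ae_iff_prob_eq_one (hmodel.poisson.measurable_pointCount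
      (measurableSet_singleton 0) (measurableSet_singleton _))).2 hlaw
  filter_upwards [hfin, hw, hzero, hmodel.obs_zero, ae_all_iff.2 hmodel.obs_step]
    with ω h1 h2 h3 h4 h5
  refine ⟨fun m => ?_, fun k hk => ?_, h1, h2⟩
  · induction m with
    | zero => simpa using h4
    | succ m ih =>
      have := h5 m
      push_cast
      linarith
  · have : {k | t k ω ∈ ({0} : Set ℝ)} = ∅ := Set.encard_eq_zero.1 (by simpa [pointCount] using h3)
    exact Set.notMem_empty k (this ▸ (show k ∈ {k | t k ω ∈ ({0} : Set ℝ)} from hk))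

end Paths

/-! ### The functional of the exit -/

section ExitFunctional

open StrikeNetwork

variable {Ω : Type*} [MeasurableSpace Ω] {P : Measure Ω}
  {t : ℕ → Ω → ℝ} {n : ℕ → Ω → ℕ} {w : ℕ → ℕ → Ω → ℝ} {τ : ℕ → Ω → ℝ}
  {lam c α ξ : ℝ} {R : ℕ} {p : Fin R → ℝ}

lemma StrikeNetwork.IsConstantObservationModel.measurable_markKernel_epoch
    (hmodel : IsConstantObservationModel P t n w τ lam c α ξ p) (v : ℂ) (V : ℝ) (k j m : ℕ) :
    Measurable fun ω => markKernel v V k j (strikesUpTo t c m ω) (strikesBetween t c m ω)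
      (fun i => n i ω, fun jk => w jk.1 jk.2 ω) := by
  have hf : Measurable fun z : (Finset ℕ × Finset ℕ) × ((ℕ → ℕ) × (ℕ × ℕ → ℝ)) =>
      markKernel v V k j z.1.1 z.1.2 z.2 :=
    measurable_from_prod_countable_right fun x => measurable_markKernel v V k j x.1 x.2
  have hw : ∀ jk : ℕ × ℕ, Measurable (w jk.1 jk.2) := fun jk => hmodel.measurable_weight _ _
  exact hf.comp (((hmodel.poisson.measurable_strikes measurableSet_Ioc).prodMk
    (hmodel.poisson.measurable_strikes measurableSet_Ioc)).prodMk
    ((measurable_pi_lambda _ hmodel.measurable_nodes).prodMk (measurable_pi_lambda _ hw)))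

variable [IsProbabilityMeasure P]

lemma StrikeNetwork.IsConstantObservationModel.integral_markKernel_epoch
    (hmodel : IsConstantObservationModel P t n w τ lam c α ξ p) (hlam : 0 < lam) (hc : 0 < c)
    (hα : 0 < α) (hξ : 0 < ξ) (hp : ∀ i, 0 ≤ p i) (hp1 : ∑ i, p i = 1) {V : ℝ} (hV : 0 < V)
    {v : ℂ} (hv : 0 ≤ v.re) (k j m : ℕ) :
    ∫ ω, markKernel v V k j (strikesUpTo t c m ω) (strikesBetween t c m ω)
        (fun i => n i ω, fun jk => w jk.1 jk.2 ω) ∂P =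
      compoundPoissonMass p (lam * (c * m)) k *
        (Complex.exp (-(lam * c)) * coeffE c lam p j * gammaTrunc α ξ V v (k + j)) := by
  have h0 : 0 ≤ c * m := by positivity
  have h := hmodel.integral_markKernel_strikes hlam hα hξ hp hp1 hV hv
    (T := Set.Ioc 0 (c * m)) (T' := Set.Ioc (c * m) (c * (m + 1))) measurableSet_Ioc
    (fun x hx => hx.1.le) (by simp) measurableSet_Ioc (fun x hx => h0.trans hx.1.le) (by simp)
    (disjoint_Ioc_epochs c m) k j
  have hv1 : volume.real (Set.Ioc 0 (c * (m : ℝ))) = c * m := by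
    rw [Real.volume_real_Ioc_of_le h0, sub_zero]
  have hv2 : volume.real (Set.Ioc (c * (m : ℝ)) (c * (m + 1))) = c := by
    rw [Real.volume_real_Ioc_of_le (by linarith)]
    ring
  rw [hv1, hv2, compoundPoissonMass_eq_coeffE p c lam j] at h
  simp only [strikesUpTo, strikesBetween]
  rw [h]
  push_cast
  ring

/-- The integrals of the contributions of the epochs sum up to the closed form. -/
lemma StrikeNetwork.IsConstantObservationModel.hasSum_integral_exit
    (hmodel : IsConstantObservationModel P t n w τ lam c α ξ p) (hlam : 0 < lam) (hc : 0 < c)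
    (hα : 0 < α) (hξ : 0 < ξ) (hp : ∀ i, 0 ≤ p i) (hp1 : ∑ i, p i = 1) {V : ℝ} (hV : 0 < V)
    {u v θ : ℂ} (hv : 0 ≤ v.re) (hθ : 0 ≤ θ.re) {M₁ M : ℕ} (hM : M₁ < M) :
    HasSum (fun m : ℕ => ∫ ω, ∑ k ∈ Finset.range (M₁ + 1),
        ∑ j ∈ (Finset.range (M - k + 1)).filter (fun j => M₁ < k + j),
          u ^ (k + j) * Complex.exp (-(θ * (c * ((m : ℂ) + 1)))) *
            markKernel v V k j (strikesUpTo t c m ω) (strikesBetween t c m ω)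
              (fun i => n i ω, fun jk => w jk.1 jk.2 ω) ∂P)
      (Complex.exp (-(c * (θ + lam))) *
        (∑ k ∈ Finset.range (M₁ + 1), coeffF c lam p θ k *
            ∑ m ∈ Finset.range (M - k + 1), (coeffE c lam p m : ℂ) *
              (u ^ (k + m) * gammaTrunc α ξ V v (k + m))
        - ∑ k ∈ Finset.range (M₁ + 1), u ^ k * gammaTrunc α ξ V v k *
            ∑ i ∈ Finset.range (k + 1), (coeffE c lam p i : ℂ) * coeffF c lam p θ (k - i))) := by
  have hR : 0 < R := by
    rcases Nat.eq_zero_or_pos R with rfl | h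
    · simp at hp1
    · exact h
  have hint : ∀ k j m : ℕ, Integrable (fun ω => u ^ (k + j) *
      Complex.exp (-(θ * (c * ((m : ℂ) + 1)))) * markKernel v V k j (strikesUpTo t c m ω)
        (strikesBetween t c m ω) (fun i => n i ω, fun jk => w jk.1 jk.2 ω)) P := fun k j m =>
    (Integrable.of_bound (hmodel.measurable_markKernel_epoch v V k j m).aestronglyMeasurable 1
      (Filter.Eventually.of_forall fun ω => norm_markKernel_le hv V k j _ _ _)).const_mul _
  have hterm : ∀ m : ℕ, ∫ ω, ∑ k ∈ Finset.range (M₁ + 1),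
        ∑ j ∈ (Finset.range (M - k + 1)).filter (fun j => M₁ < k + j),
          u ^ (k + j) * Complex.exp (-(θ * (c * ((m : ℂ) + 1)))) *
            markKernel v V k j (strikesUpTo t c m ω) (strikesBetween t c m ω)
              (fun i => n i ω, fun jk => w jk.1 jk.2 ω) ∂P =
      ∑ k ∈ Finset.range (M₁ + 1), ∑ j ∈ (Finset.range (M - k + 1)).filter (fun j => M₁ < k + j),
        Complex.exp (-(θ * (c * ((m : ℂ) + 1)))) * (compoundPoissonMass p (lam * (c * m)) k : ℂ) *
          (u ^ (k + j) *
            (Complex.exp (-(lam * c)) * coeffE c lam p j * gammaTrunc α ξ V v (k + j))) := by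
    intro m
    rw [integral_finsetSum _ fun k _ => integrable_finsetSum _ fun j _ => hint k j m]
    refine Finset.sum_congr rfl fun k _ => ?_
    rw [integral_finsetSum _ fun j _ => hint k j m]
    refine Finset.sum_congr rfl fun j _ => ?_
    rw [integral_const_mul, hmodel.integral_markKernel_epoch hlam hc hα hξ hp hp1 hV hv]
    ring
  simp_rw [hterm]
  -- The closed form is folded back into one sum over the exit region, where it can be matched term
  -- by term.
  rw [← sum_filter_lt_add hM (coeffF c lam p θ) (fun j => (coeffE c lam p j : ℂ))
    (fun s => u ^ s * gammaTrunc α ξ V v s)]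
  have hs := hasSum_sum (s := Finset.range (M₁ + 1)) fun k _ =>
    hasSum_sum (s := (Finset.range (M - k + 1)).filter (fun j => M₁ < k + j)) fun j _ =>
      (hasSum_compoundPoissonMass hR p hc hlam hθ k).mul_right (u ^ (k + j) *
        (Complex.exp (-(lam * c)) * coeffE c lam p j * gammaTrunc α ξ V v (k + j)))
  convert! hs using 1
  rw [Finset.mul_sum]
  refine Finset.sum_congr rfl fun k _ => ?_
  rw [Finset.mul_sum]
  refine Finset.sum_congr rfl fun j _ => ?_
  rw [show -((c : ℂ) * (θ + lam)) = -(c * θ) + -(lam * c) by ring, Complex.exp_add]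
  ring

end ExitFunctional

end

open StrikeNetwork in
theorem theorem4p1 {Ω : Type*} [MeasurableSpace Ω] (P : Measure Ω) [IsProbabilityMeasure P]
    (lam c α ξ : ℝ) (hlam : 0 < lam) (hc : 0 < c) (hα : 0 < α) (hξ : 0 < ξ)
    (R : ℕ) (p : Fin R → ℝ) (hp : ∀ i, 0 ≤ p i) (hp1 : ∑ i, p i = 1)
    (t : ℕ → Ω → ℝ) (n : ℕ → Ω → ℕ) (w : ℕ → ℕ → Ω → ℝ) (τ : ℕ → Ω → ℝ)
    (hmodel : IsConstantObservationModel P t n w τ lam c α ξ p)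
    (M₁ M : ℕ) (hM : M₁ < M) (V : ℝ) (hV : 0 < V)
    (N : ℕ → Ω → ℕ) (hN : N = observedNodes t n τ)
    (W : ℕ → Ω → ℝ) (hW : W = observedWeight t n w τ)
    (μ₁ μ ν : Ω → ℕ∞)
    (hμ₁ : ∀ ω, μ₁ ω = exitIndex (fun i => N i ω) M₁)
    (hμ : ∀ ω, μ ω = exitIndex (fun i => N i ω) M)
    (hν : ∀ ω, ν ω = exitIndex (fun i => W i ω) V)
    (Z : Ω → ℂ) (u v θ : ℂ) (hu : ‖u‖ ≤ 1) (hv : 0 ≤ v.re) (hθ : 0 ≤ θ.re)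
    (hZ : Z = Set.indicator {ω | μ₁ ω < min (μ ω) (ν ω)} (fun ω =>
      u ^ N (μ₁ ω).toNat ω * Complex.exp (-(v * (W (μ₁ ω).toNat ω : ℂ))) *
        Complex.exp (-(θ * (τ (μ₁ ω).toNat ω : ℂ))))) :
    Integrable Z P ∧
    ∫ ω, Z ω ∂P =
      Complex.exp (-(c * (θ + lam))) *
        (∑ k ∈ Finset.range (M₁ + 1), u ^ k * coeffF c lam p θ k *
            ∑ m ∈ Finset.range (M - k + 1), u ^ m * (coeffE c lam p m : ℂ) *
              ((ξ : ℂ) / (v + ξ)) ^ ((α * (k + m) : ℝ) : ℂ) *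
              regularizedGamma (α * (k + m)) ((v + ξ) * V)
        - ∑ k ∈ Finset.range (M₁ + 1), u ^ k *
            ((ξ : ℂ) / (ξ + v)) ^ ((α * k : ℝ) : ℂ) *
            regularizedGamma (α * k) ((v + ξ) * V) *
            ∑ i ∈ Finset.range (k + 1), (coeffE c lam p i : ℂ) * coeffF c lam p θ (k - i)) := by
  set ζ : ℕ → Ω → ℂ := fun m ω => ∑ k ∈ Finset.range (M₁ + 1),
    ∑ j ∈ (Finset.range (M - k + 1)).filter (fun j => M₁ < k + j),
      u ^ (k + j) * Complex.exp (-(θ * (c * ((m : ℂ) + 1)))) *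
        markKernel v V k j (strikesUpTo t c m ω) (strikesBetween t c m ω)
          (fun i => n i ω, fun jk => w jk.1 jk.2 ω) with hζ
  have hζmeas : ∀ m, Measurable (ζ m) := fun m =>
    Finset.measurable_sum _ fun k _ => Finset.measurable_sum _ fun j _ =>
      (hmodel.measurable_markKernel_epoch v V k j m).const_mul _
  have hpath : ∀ᵐ ω ∂P, (∀ m, ‖ζ m ω‖ ≤ 1) ∧
      ∃ m, (∀ m' ≠ m, ζ m' ω = 0) ∧ ζ m ω = Z ω := by
    filter_upwards [hmodel.ae_isRegularPath hlam] with ω hω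
    have hexit : ∀ m, ζ m ω = exitTerm u v θ V M₁ M (fun m => N m ω) (fun m => W m ω)
        (fun m => τ m ω) m := fun m => by
      rw [hN, hW]
      exact (hω.exitTerm_eq_sum_markKernel hc hM u v θ V m).symm
    have hNmono : Monotone fun m => N m ω := hN ▸ IsRegularPath.monotone_observedNodes ω
    have hN0 : N 0 ω = 0 := by
      rw [hN, hω.observedNodes_eq hc, IsRegularPath.strikesUpTo_zero, Finset.sum_empty]
    have hWmono : Monotone fun m => W m ω := hW ▸ hω.monotone_observedWeight hc
    have hW0 : ∀ m, 0 ≤ W m ω := fun m => by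
      rw [hW, hω.observedWeight_eq hc]
      exact hω.markWeight_nonneg _
    have hτ0 : ∀ m, 0 ≤ τ m ω := fun m => by
      rw [hω.obs]
      positivity
    simp only [hexit]
    refine ⟨fun m => norm_exitTerm_le hu hv hθ V M₁ M _ hW0 hτ0 m, ?_⟩
    obtain ⟨m, h1, h2⟩ := exists_exitTerm (u := u) (v := v) (θ := θ) (V := V) (M := M)
      (fun m => τ m ω) hNmono hN0 hWmono (hμ₁ ω)
    refine ⟨m, h1, h2.trans ?_⟩
    rw [hZ, ← hμ, ← hν, Set.indicator]
    simp only [Set.mem_ofPred_eq]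
    congr
  have hlim : ∀ᵐ ω ∂P, Filter.Tendsto (fun L => ∑ m ∈ Finset.range L, ζ m ω) Filter.atTop
      (nhds (Z ω)) := by
    filter_upwards [hpath] with ω hω
    obtain ⟨-, m, h1, h2⟩ := hω
    rw [← h2]
    exact (hasSum_single m h1).tendsto_sum_nat
  -- At most one term is nonzero on each path, so the bound on a single term also bounds every
  -- partial sum.
  have hbound : ∀ᵐ ω ∂P, ∀ L, ‖∑ m ∈ Finset.range L, ζ m ω‖ ≤ 1 := by
    filter_upwards [hpath] with ω hω L
    obtain ⟨h0, m, h1, -⟩ := hω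
    by_cases hm : m ∈ Finset.range L
    · rw [Finset.sum_eq_single_of_mem m hm fun m' _ hm' => h1 m' hm']
      exact h0 m
    · rw [Finset.sum_eq_zero fun m' hm' => h1 m' fun h => hm (h ▸ hm')]
      simp
  have hSmeas : ∀ L, AEStronglyMeasurable (fun ω => ∑ m ∈ Finset.range L, ζ m ω) P := fun L =>
    (Finset.measurable_sum _ fun m _ => hζmeas m).aestronglyMeasurable
  have hZbound : ∀ᵐ ω ∂P, ‖Z ω‖ ≤ 1 := by
    filter_upwards [hpath] with ω hω
    obtain ⟨h0, m, -, h2⟩ := hω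
    exact h2 ▸ h0 m
  have hζint : ∀ m, Integrable (ζ m) P := fun m =>
    Integrable.of_bound (hζmeas m).aestronglyMeasurable 1 (hpath.mono fun ω hω => hω.1 m)
  -- Measurability of `Z` is inherited from the partial sums, which do not involve `τ`; the model
  -- does not assume `τ` measurable.
  refine ⟨Integrable.of_bound (aestronglyMeasurable_of_tendsto_ae _ hSmeas hlim) 1 hZbound, ?_⟩
  have htend := tendsto_integral_filter_of_norm_le_const (l := Filter.atTop)
    (Filter.Eventually.of_forall hSmeas)
    ⟨1, Filter.Eventually.of_forall fun L => hbound.mono fun ω hω => hω L⟩ hlim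
  simp_rw [integral_finsetSum _ fun m _ => hζint m] at htend
  have hsum := (hmodel.hasSum_integral_exit hlam hc hα hξ hp hp1 hV (u := u) hv hθ
    hM).tendsto_sum_nat
  rw [tendsto_nhds_unique htend hsum]
  congr 2
  · refine Finset.sum_congr rfl fun k _ => ?_
    rw [Finset.mul_sum, Finset.mul_sum]
    refine Finset.sum_congr rfl fun m _ => ?_
    rw [gammaTrunc, Nat.cast_add, pow_add]
    ring
  · refine Finset.sum_congr rfl fun k _ => ?_
    rw [gammaTrunc, add_comm v]
    ring
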